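/- **Example 3.10.** Let $I(\mathbb R^3)=O(3)\ltimes\mathbb R^3$ be the isometry group of Euclidean $\mathbb R^3$ (with the compact-open topology), let $L_b$ be the translation $x\mapsto x+b$, let $\Lambda=2\mathbb Z\times2\mathbb Z\times2\mathbb Z$, and let $T_\Lambda=\mathbb R^3/\Lambda$ be the flat torus. Let $$\chi_1=\operatorname{diag}(-1,1,1),\quad \chi_2=\operatorname{diag}(-1,-1,1),\quad \chi_3=\operatorname{diag}(1,-1,1),$$ $$b_1=b_3=e_1+e_2,\quad b_2=0,\qquad b_1'=b_3'=e_3,\quad b_2'=0,$$ $\rho_j=\chi_j\circ L_{b_j}$, $\rho_j'=\chi_j\circ L_{b_j'}$ for $j=1,2,3$, $\rho_0=\rho_0'=\mathrm{Id}$, and $$\Gamma_1=\{\rho_jL_\lambda : 0\le j\le 3,\ \lambda\in\Lambda\},\qquad \Gamma_2=\{\rho_j'L_\lambda : 0\le j\le 3,\ \lambda\in\Lambda\}.$$ 1. $\Gamma_1$ and $\Gamma_2$ are discrete and cocompact subgroups of $I(\mathbb R^3)$. The flat orbifolds $\mathcal O_i=\Gamma_i\backslash\mathbb R^3$ ($i=1,2$)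 are not orientable. The box $[0,1]\times[0,1]\times[0,2]$ is a fundamental domain for both groups (its translates cover $\mathbb R^3$, and the translates of its interior by different elements are disjoint), and the underlying topological space of $\mathcal O_1$ is homeomorphic to $\mathbb RP^2\times S^1$. 2. The elements of $\Gamma_1$, $\Gamma_2$ and the maps $BL_b$, where $B$ is a permutation matrix and $b\in\frac14\Lambda$, descend to isometries of $T_\Lambda$. The groups of isometries of $T_\Lambda$ induced by $\Gamma_1$ and $\Gamma_2$ are $\bar\Gamma_1=\{\overline{\rho_j} : 0\le j\le3\}$ and $\bar\Gamma_2=\{\overline{\rho_j'} : 0\le j\le 3\}$, and $\mathcal O_i$ is isometric to $\bar\Gamma_i\backslash T_\Lambda$ for $i=1,2$. Let $G$ be the group generated by $\bar\Gamma_1$, $\bar\Gamma_2$ and all $\overline{BL_b}$ as above. Then $G$ is finite, and $\bar\Gamma_1$ and $\bar\Gamma_2$ are almost conjugate in $G$: each conjugacy class of $G$ meets both of them in the same number of elements. Hence $\mathcal O_1$ and $\mathcal O_2$ are Sunada-isospectral; in particular, for each $\mu\in\mathbb R$ the spaces of $\Gamma_i$-invariant smooth functions $f:\mathbb R^3\to\mathbb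 R$ with $-\sum_j\partial_j^2f=\mu f$ are finite-dimensional and have the same dimension for $i=1,2$. 3. $\mathcal O_1$ and $\mathcal O_2$ are not isometric as Riemannian orbifolds. For both $i$, the set of points of $\mathbb R^3$ fixed by some nontrivial element of $\Gamma_i$ is $\mathbb Z\times\mathbb Z\times\mathbb R$; each of these points is fixed by exactly one nontrivial element of $\Gamma_i$, and so its isotropy group is $\cong\mathbb Z_2$. The singular set (the set of points with nontrivial isotropy) of $\mathcal O_1$ is the disjoint union of two circles of length two, and that of $\mathcal O_2$ is the disjoint union of four circles of length one; so these singular sets have $2$ and $4$ connected components, respectively. -/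

import Mathlib

open scoped ContDiff

noncomputable section

namespace FlatOrbifold

/-! ### Good Riemannian orbifolds `Γ \ M`, for a group `Γ` of isometries of `M` -/

section General

variable {M N : Type*} [PseudoMetricSpace M] [PseudoMetricSpace N]

/-- The isometry group of `M` acts on `M` by evaluation. -/
instance isometryAction : MulAction (M ≃ᵢ M) M where
  smul g x := g x
  one_smul _ := rfl
  mul_smul _ _ _ := rfl

/-- The compact-open topology on the isometry group. -/
instance isometryGroupTopology : TopologicalSpace (M ≃ᵢ M) :=
  TopologicalSpace.induced
    (fun g => (⟨g, g.continuous⟩ : ContinuousMap M M)) inferInstance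

/-- The underlying space of `Γ \ M`, with the quotient topology. -/
abbrev OrbitSpace (Γ : Subgroup (M ≃ᵢ M)) : Type _ :=
  Quotient (MulAction.orbitRel Γ M)

/-- The canonical projection `M → Γ \ M`. -/
def proj (Γ : Subgroup (M ≃ᵢ M)) (x : M) : OrbitSpace Γ :=
  Quotient.mk (MulAction.orbitRel Γ M) x

/-- The quotient distance: the infimum of the distances between representatives. -/
def orbitDist (Γ : Subgroup (M ≃ᵢ M)) (p q : OrbitSpace Γ) : ℝ :=
  sInf {r : ℝ | ∃ x y : M, proj Γ x = p ∧ proj Γ y = q ∧ r = dist x y}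

/-- The isotropy group of the image of `x` in `Γ \ M`. -/
abbrev isotropy (Γ : Subgroup (M ≃ᵢ M)) (x : M) : Subgroup Γ :=
  MulAction.stabilizer Γ x

/-- The singular set of `Γ \ M`: the image of the points with nontrivial stabilizer. -/
def singularSet (Γ : Subgroup (M ≃ᵢ M)) : Set (OrbitSpace Γ) :=
  {p | ∃ x : M, proj Γ x = p ∧ isotropy Γ x ≠ ⊥}

/-- `Γ \ M` and `Γ' \ N` are isometric as Riemannian orbifolds: there is a homeomorphism of the
underlying spaces which near every point lifts to an isometry from an open subset of `M` onto an
open subset of `N`. -/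
def OrbifoldIsometric (Γ : Subgroup (M ≃ᵢ M)) (Γ' : Subgroup (N ≃ᵢ N)) : Prop :=
  ∃ f : OrbitSpace Γ ≃ₜ OrbitSpace Γ', ∀ x : M, ∃ φ : OpenPartialHomeomorph M N,
    x ∈ φ.source ∧
    (∀ y ∈ φ.source, ∀ z ∈ φ.source, dist (φ y) (φ z) = dist y z) ∧
    ∀ y ∈ φ.source, f (proj Γ y) = proj Γ' (φ y)

/-- The subset `S` of `Γ \ M` is the disjoint union of `n` circles of length `ℓ`: it is homeomorphic
to the disjoint union of `n` copies of `ℝ / ℓℤ` in such a way that each copy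
is mapped locally isometrically. -/
def IsDisjointUnionOfCircles (Γ : Subgroup (M ≃ᵢ M)) (S : Set (OrbitSpace Γ)) (n : ℕ) (ℓ : ℝ) :
    Prop :=
  ∃ e : (Fin n × AddCircle ℓ) ≃ₜ S, ∀ (i : Fin n) (s : AddCircle ℓ), ∃ U ∈ nhds s,
    ∀ t ∈ U, ∀ t' ∈ U, orbitDist Γ (e (i, t) : OrbitSpace Γ) (e (i, t')) = dist t t'

/-- `D` is a (closed) fundamental domain for `Γ`: its translates cover `M`, and the interiors of
the translates by different elements are disjoint. -/
def IsClosedFundamentalDomain (Γ : Subgroup (M ≃ᵢ M)) (D : Set M) : Prop :=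
  IsClosed D ∧ (∀ x : M, ∃ g ∈ Γ, g x ∈ D) ∧
    ∀ g ∈ Γ, g ≠ 1 → Disjoint (g '' interior D) (interior D)

/-- A discrete and cocompact group of isometries. -/
def IsCrystallographic (Γ : Subgroup (M ≃ᵢ M)) : Prop :=
  DiscreteTopology Γ ∧ CompactSpace ((M ≃ᵢ M) ⧸ Γ)

end General

/-- Two finite subgroups of `G` are almost conjugate in `G` if each conjugacy class of `G` meets them
in the same number of elements. -/
def AlmostConjugate {G : Type*} [Group G] (H₁ H₂ : Subgroup G) : Prop :=
  Finite H₁ ∧ Finite H₂ ∧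
    ∀ b : G, (conjugatesOf b ∩ (H₁ : Set G)).ncard = (conjugatesOf b ∩ (H₂ : Set G)).ncard

/-! ### Flat orbifolds `Γ \ ℝⁿ` -/

/-- Euclidean space `ℝⁿ`. -/
abbrev E (n : ℕ) : Type := EuclideanSpace ℝ (Fin n)

/-- The translation `L_b : x ↦ x + b`. -/
def transl {n : ℕ} (b : E n) : E n ≃ᵢ E n := IsometryEquiv.addRight b

theorem isometry_mulVec {n : ℕ} (B : Matrix.orthogonalGroup (Fin n) ℝ) :
    Isometry (fun x : E n => (WithLp.toLp 2 (B.1.mulVec x.ofLp) : E n)) := by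
  refine Isometry.of_dist_eq fun x y => ?_
  have h : B.1.transpose * B.1 = 1 := by
    have := (Matrix.mem_orthogonalGroup_iff' (Fin n) ℝ).1 B.2
    simpa [Matrix.star_eq_conjTranspose] using this
  rw [dist_eq_norm, dist_eq_norm]
  have key : ∀ z : E n, ‖(WithLp.toLp 2 (B.1.mulVec z.ofLp) : E n)‖ ^ 2 = ‖z‖ ^ 2 := by
    intro z
    rw [← real_inner_self_eq_norm_sq, ← real_inner_self_eq_norm_sq]
    simp only [EuclideanSpace.inner_eq_star_dotProduct, star_trivial]
    rw [Matrix.dotProduct_mulVec, ← Matrix.mulVec_transpose, Matrix.mulVec_mulVec, h,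
      Matrix.one_mulVec]
  have := key (x - y)
  rw [sq_eq_sq₀ (norm_nonneg _) (norm_nonneg _)] at this
  rw [← this, ← WithLp.toLp_sub, ← Matrix.mulVec_sub, WithLp.ofLp_sub]

/-- The linear isometry `x ↦ B x` for `B ∈ O(n)`. -/
def ortho {n : ℕ} (B : Matrix.orthogonalGroup (Fin n) ℝ) : E n ≃ᵢ E n :=
  IsometryEquiv.mk' (fun x => WithLp.toLp 2 (B.1.mulVec x.ofLp))
    (fun x => WithLp.toLp 2 ((B⁻¹).1.mulVec x.ofLp))
    (fun x => by
      have h : B.1 * (B⁻¹).1 = 1 := congrArg Subtype.val (mul_inv_cancel B)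
      simp only [Matrix.mulVec_mulVec, h, Matrix.one_mulVec])
    (isometry_mulVec B)

/-- `Γ \ ℝⁿ` is orientable: there is a continuous (that is, locally constant) choice of orientations
of the tangent spaces of `ℝⁿ` which is invariant under the differentials of the elements of `Γ`. -/
def Orientable {n : ℕ} (Γ : Subgroup (E n ≃ᵢ E n)) : Prop :=
  ∃ o : E n → Orientation ℝ (E n) (Fin n), IsLocallyConstant o ∧
    ∀ g ∈ Γ, ∀ x : E n,
      Orientation.map (Fin n) g.toRealAffineIsometryEquiv.linearIsometryEquiv.toLinearEquiv (o x) =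
        o (g x)

/-- The `μ`-eigenspace of the (positive) Laplace operator on the space `C^∞(Γ \ ℝⁿ) = C^∞(ℝⁿ)^Γ` of
smooth functions on `Γ \ ℝⁿ`. -/
def eigenspace {n : ℕ} (Γ : Subgroup (E n ≃ᵢ E n)) (μ : ℝ) : Submodule ℝ (E n → ℝ) where
  carrier := {f | ContDiff ℝ ∞ f ∧ (∀ g ∈ Γ, ∀ x, f (g x) = f x) ∧
    ∀ x, -(Laplacian.laplacian f x) = μ * f x}
  zero_mem' := by
    refine ⟨contDiff_const, fun _ _ _ => rfl, fun x => ?_⟩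
    have h : Laplacian.laplacian (0 : E n → ℝ) = 0 :=
      InnerProductSpace.laplacian_const (E := E n) (c := (0 : ℝ))
    rw [h]
    simp
  add_mem' := by
    rintro f h ⟨hf, hf', hf''⟩ ⟨hh, hh', hh''⟩
    refine ⟨hf.add hh, fun g hg x => ?_, fun x => ?_⟩
    · simp only [Pi.add_apply, hf' g hg, hh' g hg]
    · have h1 : ContDiffAt ℝ 2 f x := (hf.of_le (by exact WithTop.coe_le_coe.2 le_top)).contDiffAt
      have h2 : ContDiffAt ℝ 2 h x := (hh.of_le (by exact WithTop.coe_le_coe.2 le_top)).contDiffAt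
      rw [h1.laplacian_add h2, neg_add, hf'', hh'', Pi.add_apply, mul_add]
  smul_mem' := by
    rintro c f ⟨hf, hf', hf''⟩
    refine ⟨contDiff_const.smul hf, fun g hg x => ?_, fun x => ?_⟩
    · simp only [Pi.smul_apply, hf' g hg]
    · have h1 : ContDiffAt ℝ 2 f x := (hf.of_le (by exact WithTop.coe_le_coe.2 le_top)).contDiffAt
      rw [InnerProductSpace.laplacian_smul c h1, smul_eq_mul, ← mul_neg, hf'', Pi.smul_apply,
        smul_eq_mul]
      ring

/-- `Γ₁ \ ℝⁿ` and `Γ₂ \ ℝⁿ` have the same Laplace spectrum on functions: every number is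
an eigenvalue of the same finite multiplicity (possibly zero) for both. -/
def Isospectral {n : ℕ} (Γ₁ Γ₂ : Subgroup (E n ≃ᵢ E n)) : Prop :=
  ∀ μ : ℝ, FiniteDimensional ℝ (eigenspace Γ₁ μ) ∧ FiniteDimensional ℝ (eigenspace Γ₂ μ) ∧
    Module.finrank ℝ (eigenspace Γ₁ μ) = Module.finrank ℝ (eigenspace Γ₂ μ)

/-! ### The flat torus `T_Λ = ℝⁿ / Λ` -/

/-- The flat torus, with the quotient metric. -/
abbrev Torus {n : ℕ} (Λ : AddSubgroup (E n)) : Type := E n ⧸ Λ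

/-- `h` is the map of the torus induced by `g`. -/
def Induces {n : ℕ} {Λ : AddSubgroup (E n)} (g : E n ≃ᵢ E n) (h : Torus Λ ≃ᵢ Torus Λ) : Prop :=
  ∀ x : E n, h (QuotientAddGroup.mk x) = QuotientAddGroup.mk (g x)

/-- The group of all isometries of the torus which are induced by elements of `Γ`. -/
def inducedGroup {n : ℕ} (Λ : AddSubgroup (E n)) (Γ : Subgroup (E n ≃ᵢ E n)) :
    Subgroup (Torus Λ ≃ᵢ Torus Λ) where
  carrier := {h | ∃ g ∈ Γ, Induces g h}
  one_mem' := ⟨1, Γ.one_mem, fun _ => rfl⟩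
  mul_mem' := by
    rintro h k ⟨g, hg, hgh⟩ ⟨l, hl, hlk⟩
    refine ⟨g * l, Γ.mul_mem hg hl, fun x => ?_⟩
    rw [IsometryEquiv.mul_apply, hlk, hgh, IsometryEquiv.mul_apply]
  inv_mem' := by
    rintro h ⟨g, hg, hgh⟩
    refine ⟨g⁻¹, Γ.inv_mem hg, fun x => ?_⟩
    apply h.injective
    rw [IsometryEquiv.apply_inv_self, hgh, IsometryEquiv.apply_inv_self]

/-- The flat orbifolds `Γ₁ \ ℝⁿ` and `Γ₂ \ ℝⁿ` are Sunada-isospectral by means of the group `G`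
of isometries of the torus and its subgroups `H₁`, `H₂`: these are finite and almost conjugate
in `G`, their quotients of the torus are the two orbifolds, and the orbifolds are isospectral. -/
structure SunadaIsospectralVia {n : ℕ} {Λ : AddSubgroup (E n)}
    (G H₁ H₂ : Subgroup (Torus Λ ≃ᵢ Torus Λ)) (Γ₁ Γ₂ : Subgroup (E n ≃ᵢ E n)) : Prop where
  le₁ : H₁ ≤ G
  le₂ : H₂ ≤ G
  almostConjugate : AlmostConjugate (H₁.subgroupOf G) (H₂.subgroupOf G)
  quotient₁ : OrbifoldIsometric Γ₁ H₁
  quotient₂ : OrbifoldIsometric Γ₂ H₂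
  isospectral : Isospectral Γ₁ Γ₂

/-! ### The two orbifolds -/

/-- The lattice `Λ = 2ℤ × 2ℤ × 2ℤ`. -/
def Lam : AddSubgroup (E 3) where
  carrier := {v | ∀ i, ∃ m : ℤ, v i = 2 * m}
  zero_mem' := fun _ => ⟨0, by simp⟩
  add_mem' := by
    intro a b ha hb i
    obtain ⟨m, hm⟩ := ha i
    obtain ⟨k, hk⟩ := hb i
    exact ⟨m + k, by simp [hm, hk, mul_add]⟩
  neg_mem' := by
    intro a ha i
    obtain ⟨m, hm⟩ := ha i
    exact ⟨-m, by simp [hm]⟩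

theorem diagonal_mem (s : Fin 3 → ℝ) (hs : ∀ i, s i * s i = 1) :
    Matrix.diagonal s ∈ Matrix.orthogonalGroup (Fin 3) ℝ := by
  rw [Matrix.mem_orthogonalGroup_iff, Matrix.diagonal_transpose, Matrix.diagonal_mul_diagonal, ← Matrix.diagonal_one]
  congr 1
  funext i
  exact hs i

/-- The linear parts: `χ₀ = Id`, `χ₁ = diag(-1,1,1)`, `χ₂ = diag(-1,-1,1)`, `χ₃ = diag(1,-1,1)`. -/
def chi : Fin 4 → Matrix.orthogonalGroup (Fin 3) ℝ :=
  ![1,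
    ⟨Matrix.diagonal ![-1, 1, 1], diagonal_mem _ (by simp [Fin.forall_fin_succ])⟩,
    ⟨Matrix.diagonal ![-1, -1, 1], diagonal_mem _ (by simp [Fin.forall_fin_succ])⟩,
    ⟨Matrix.diagonal ![1, -1, 1], diagonal_mem _ (by simp [Fin.forall_fin_succ])⟩]

/-- The translational parts for the first group: `0, e₁ + e₂, 0, e₁ + e₂`. -/
def trans₁ : Fin 4 → E 3 := ![0, !₂[1, 1, 0], 0, !₂[1, 1, 0]]

/-- The translational parts for the second group: `0, e₃, 0, e₃`. -/
def trans₂ : Fin 4 → E 3 := ![0, !₂[0, 0, 1], 0, !₂[0, 0, 1]]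

/-- The isometries `ρ_j = χ_j ∘ L_{b_j}`. -/
def rho (b : Fin 4 → E 3) (j : Fin 4) : E 3 ≃ᵢ E 3 := ortho (chi j) * transl (b j)

/-- The set `{ρ_j L_λ | j ∈ {0,1,2,3}, λ ∈ Λ}`. -/
def rhoSet (b : Fin 4 → E 3) : Set (E 3 ≃ᵢ E 3) :=
  {g | ∃ j : Fin 4, ∃ v ∈ Lam, g = rho b j * transl v}

/-- The group `Γ₁`. -/
def Gam₁ : Subgroup (E 3 ≃ᵢ E 3) := Subgroup.closure (rhoSet trans₁)

/-- The group `Γ₂`. -/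
def Gam₂ : Subgroup (E 3 ≃ᵢ E 3) := Subgroup.closure (rhoSet trans₂)

/-- The isometries `B L_b` with `B` a permutation matrix and `b ∈ Λ/4`. -/
def permSet : Set (E 3 ≃ᵢ E 3) :=
  {g | ∃ B : Matrix.orthogonalGroup (Fin 3) ℝ, ∃ b : E 3,
    (∃ σ : Equiv.Perm (Fin 3), B.1 = σ.permMatrix ℝ) ∧ (4 : ℝ) • b ∈ Lam ∧
      g = ortho B * transl b}

/-- The subgroup `G` of the isometry group of the torus generated by the groups induced by `Γ₁` and
`Γ₂` and by the maps induced by the `B L_b`, `B` a permutation matrix and `b ∈ Λ/4`. -/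
def bigGroup : Subgroup (Torus Lam ≃ᵢ Torus Lam) :=
  Subgroup.closure ((inducedGroup Lam Gam₁ : Set (Torus Lam ≃ᵢ Torus Lam)) ∪
    (inducedGroup Lam Gam₂ : Set (Torus Lam ≃ᵢ Torus Lam)) ∪
    {h | ∃ g ∈ permSet, Induces g h})

/-- The box `[0,1] × [0,1] × [0,2]`. -/
def box : Set (E 3) :=
  {x | x 0 ∈ Set.Icc (0 : ℝ) 1 ∧ x 1 ∈ Set.Icc (0 : ℝ) 1 ∧ x 2 ∈ Set.Icc (0 : ℝ) 2}

/-- The set `ℤ × ℤ × ℝ`. -/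
def verticalLines : Set (E 3) := {x | (∃ m : ℤ, x 0 = m) ∧ ∃ m : ℤ, x 1 = m}

/-- The antipodal relation on the unit sphere of `ℝ³`. -/
def antipodal : Setoid (Metric.sphere (0 : E 3) 1) where
  r x y := x = y ∨ x = -y
  iseqv :=
    { refl := fun _ => Or.inl rfl
      symm := by
        rintro x y (h | h)
        · exact Or.inl h.symm
        · exact Or.inr (by rw [h, neg_neg])
      trans := by
        rintro x y z (h | h) (h' | h')
        · exact Or.inl (h.trans h')
        · exact Or.inr (h.trans h')
        · exact Or.inr (by rw [h, h'])
        · exact Or.inl (by rw [h, h', neg_neg]) }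

/-- The real projective plane. -/
abbrev ProjectivePlane : Type := Quotient antipodal

end FlatOrbifold

end

open FlatOrbifold

namespace FlatOrbifold

/-! ### Coordinates of the elements of `Γ₁` and `Γ₂` -/

/-! The linear parts form a Klein four-group in which indices multiply by bitwise xor, and the
offsets are a cocycle modulo two. Hence each group consists of the maps x ↦ χ_j x + c_j + 2m with m
integral (`HasOffsets`), and most geometric claims become parity arguments on coordinates.

For j = 1, 3 some coordinate that is not reflected moves by an odd integer, so nontrivial elements
with fixed points are half-turns about vertical lines through integer points. Under Γ₁ such lines
are classified by the parity of the sum of their two coordinates, and heights move by even integers: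
two circles of length two. Under Γ₂ both parities are invariant, but heights can move by one: four
circles of length one. Singular points are those where the projection to the orbit space is not
locally injective, a property preserved by orbifold isometries (`locallyInjectiveAt_iff`), so 2 ≠ 4
rules out an isometry.

For j = 1, 3 both ρ_j and ρ'_j are glide reflections of glide length one, and ρ_j = ρ'_j otherwise.
A coordinate permutation with a quarter-lattice translation, depending on j, conjugates one to the
other (`conjIsom_mul_rho`); this gives almost conjugacy. Averaging over the ρ_j projects an
eigenspace of the torus onto the invariant functions, so the dimension is a quarter of the sum of
the traces of the ρ_j, and traces are conjugation invariant (`trace_pullback_eq`). The torus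
eigenspaces are finite-dimensional because Green's identity kills all but finitely many Fourier
coefficients (`torusCoeff_eq_zero`).

The plane modulo half-turns and even translations is a pillow, realized as a surface meeting each
ray from the origin once. The remaining cosets of Γ₁ act on it as the antipodal map, whence the
factor ℝP²; the third coordinate modulo two gives the circle. -/

/-- The diagonal entries of the matrices `χ_j`. -/
def sgn : Fin 4 → Fin 3 → ℤ := ![![1, 1, 1], ![-1, 1, 1], ![-1, -1, 1], ![1, -1, 1]]

/-- The coordinates of `trans₁`. -/
def off₁ : Fin 4 → Fin 3 → ℤ := ![![0, 0, 0], ![1, 1, 0], ![0, 0, 0], ![1, 1, 0]]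

/-- The coordinates of `trans₂`. -/
def off₂ : Fin 4 → Fin 3 → ℤ := ![![0, 0, 0], ![0, 0, 1], ![0, 0, 0], ![0, 0, 1]]

theorem sgn_cases (j : Fin 4) (i : Fin 3) : sgn j i = 1 ∨ sgn j i = -1 := by
  revert j i; decide

theorem trans₁_apply (j : Fin 4) (i : Fin 3) : trans₁ j i = off₁ j i := by
  fin_cases j <;> fin_cases i <;> simp [trans₁, off₁]

theorem trans₂_apply (j : Fin 4) (i : Fin 3) : trans₂ j i = off₂ j i := by
  fin_cases j <;> fin_cases i <;> simp [trans₂, off₂]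

theorem chi_val (j : Fin 4) : (chi j).1 = Matrix.diagonal (fun i => (sgn j i : ℝ)) := by
  ext a b
  fin_cases j <;> fin_cases a <;> fin_cases b <;> simp [chi, sgn, Matrix.diagonal]

theorem ortho_apply {n : ℕ} (B : Matrix.orthogonalGroup (Fin n) ℝ) (x : E n) (i : Fin n) :
    ortho B x i = B.1.mulVec x.ofLp i := rfl

theorem transl_apply {n : ℕ} (b x : E n) : transl b x = x + b := rfl

theorem rho_apply (b : Fin 4 → E 3) (j : Fin 4) (x : E 3) (i : Fin 3) :
    rho b j x i = sgn j i * (x i + b j i) := by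
  rw [rho, IsometryEquiv.mul_apply, ortho_apply, chi_val, Matrix.mulVec_diagonal, transl_apply]
  simp

/-- Moving the translation past `χ_j` turns `c` into `-c` in the reflected coordinates. As these
differ by the even number `2c`, the offset can stay `c` if `m` absorbs the difference. -/
theorem mem_rhoSet_iff {b : Fin 4 → E 3} {c : Fin 4 → Fin 3 → ℤ} (hb : ∀ j i, b j i = c j i)
    (g : E 3 ≃ᵢ E 3) :
    g ∈ rhoSet b ↔
      ∃ (j : Fin 4) (m : Fin 3 → ℤ), ∀ x i, g x i = sgn j i * x i + (2 * m i + c j i) := by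
  constructor
  · rintro ⟨j, v, hv, rfl⟩
    choose n hn using hv
    refine ⟨j, fun i => sgn j i * n i + if sgn j i = 1 then 0 else -c j i, fun x i => ?_⟩
    rw [IsometryEquiv.mul_apply, rho_apply, transl_apply, PiLp.add_apply, hn, hb]
    rcases sgn_cases j i with h | h <;> simp [h] <;> ring
  · rintro ⟨j, m, hg⟩
    refine ⟨j, WithLp.toLp 2 fun i =>
      2 * ((sgn j i * m i + if sgn j i = 1 then 0 else -c j i : ℤ) : ℝ), fun i => ⟨_, rfl⟩, ?_⟩
    ext x i
    rw [IsometryEquiv.mul_apply, rho_apply, transl_apply, PiLp.add_apply, hg, hb]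
    rcases sgn_cases j i with h | h <;> simp [h] <;> ring

theorem sgn_xor (j k : Fin 4) (i : Fin 3) : sgn (j ^^^ k) i = sgn j i * sgn k i := by
  revert j k i; decide

/-- `hc` is the cocycle condition modulo two, which gives closure under products. Inverses need no
condition: in a reflected coordinate the map is its own inverse. -/
theorem closure_rhoSet {b : Fin 4 → E 3} {c : Fin 4 → Fin 3 → ℤ} (hb : ∀ j i, b j i = c j i)
    (hc : ∀ j k i, (c j i + sgn j i * c k i - c (j ^^^ k) i) % 2 = 0) (h0 : c 0 = 0) :
    (Subgroup.closure (rhoSet b) : Set (E 3 ≃ᵢ E 3)) = rhoSet b := by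
  refine Set.Subset.antisymm (fun g hg => ?_) Subgroup.subset_closure
  induction hg using Subgroup.closure_induction with
  | mem g hg => exact hg
  | one =>
    rw [mem_rhoSet_iff hb]
    exact ⟨0, 0, fun x i => by fin_cases i <;> simp [h0, sgn]⟩
  | mul g h _ _ hg hh =>
    rw [mem_rhoSet_iff hb] at hg hh ⊢
    obtain ⟨j, m, hg⟩ := hg
    obtain ⟨k, n, hh⟩ := hh
    choose d hd using fun i => Int.dvd_of_emod_eq_zero (hc j k i)
    refine ⟨j ^^^ k, fun i => m i + sgn j i * n i + d i, fun x i => ?_⟩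
    rw [IsometryEquiv.mul_apply, hg, hh, sgn_xor]
    have := congrArg (Int.cast : ℤ → ℝ) (hd i)
    push_cast at this ⊢
    linear_combination this
  | inv g _ hg =>
    rw [mem_rhoSet_iff hb] at hg ⊢
    obtain ⟨j, m, hg⟩ := hg
    refine ⟨j, fun i => if sgn j i = 1 then -m i - c j i else m i, fun x i => ?_⟩
    have := hg (g⁻¹ x) i
    rw [IsometryEquiv.apply_inv_self] at this
    rcases sgn_cases j i with h | h <;> simp [h] at this ⊢ <;> linarith

theorem coe_Gam₁ : (Gam₁ : Set (E 3 ≃ᵢ E 3)) = rhoSet trans₁ :=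
  closure_rhoSet trans₁_apply (by decide) (by decide)

theorem coe_Gam₂ : (Gam₂ : Set (E 3 ≃ᵢ E 3)) = rhoSet trans₂ :=
  closure_rhoSet trans₂_apply (by decide) (by decide)

/-- The elements of `Γ` are the isometries with linear part `χ_j` and translational part
in `c j + Λ`. -/
def HasOffsets (Γ : Subgroup (E 3 ≃ᵢ E 3)) (c : Fin 4 → Fin 3 → ℤ) : Prop :=
  ∀ g : E 3 ≃ᵢ E 3, g ∈ Γ ↔
    ∃ (j : Fin 4) (m : Fin 3 → ℤ), ∀ x i, g x i = sgn j i * x i + (2 * m i + c j i)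

theorem hasOffsets₁ : HasOffsets Gam₁ off₁ := fun g => by
  rw [← mem_rhoSet_iff trans₁_apply, ← coe_Gam₁, SetLike.mem_coe]

theorem hasOffsets₂ : HasOffsets Gam₂ off₂ := fun g => by
  rw [← mem_rhoSet_iff trans₂_apply, ← coe_Gam₂, SetLike.mem_coe]

/-- The isometry `x ↦ χ_j x + b`. -/
noncomputable def diagIsom (j : Fin 4) (b : Fin 3 → ℤ) : E 3 ≃ᵢ E 3 :=
  transl (WithLp.toLp 2 fun i => (b i : ℝ)) * ortho (chi j)

theorem diagIsom_apply (j : Fin 4) (b : Fin 3 → ℤ) (x : E 3) (i : Fin 3) :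
    diagIsom j b x i = sgn j i * x i + b i := by
  rw [diagIsom, IsometryEquiv.mul_apply, transl_apply, PiLp.add_apply, ortho_apply, chi_val,
    Matrix.mulVec_diagonal]

theorem HasOffsets.diagIsom_mem {Γ : Subgroup (E 3 ≃ᵢ E 3)} {c : Fin 4 → Fin 3 → ℤ}
    (h : HasOffsets Γ c) (j : Fin 4) (m : Fin 3 → ℤ) : diagIsom j (fun i => 2 * m i + c j i) ∈ Γ :=
  (h _).2 ⟨j, m, fun x i => by rw [diagIsom_apply]; push_cast; ring⟩

theorem HasOffsets.exists_mem {Γ : Subgroup (E 3 ≃ᵢ E 3)} {c : Fin 4 → Fin 3 → ℤ}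
    (h : HasOffsets Γ c) (j : Fin 4) (m : Fin 3 → ℤ) :
    ∃ g ∈ Γ, ∀ x i, g x i = sgn j i * x i + (2 * m i + c j i) :=
  ⟨_, h.diagIsom_mem j m, fun x i => by rw [diagIsom_apply]; push_cast; ring⟩

/-! ### Fixed points -/

/-- A translation with a fixed point is trivial, and for `j = 1, 3` an unreflected coordinate moves
by an odd integer. Only the half-turns `j = 2` remain, and the fixed point determines their
translational part. -/
theorem fixed_mem_verticalLines {Γ : Subgroup (E 3 ≃ᵢ E 3)} {g : E 3 ≃ᵢ E 3} {x : E 3}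
    (hΓ : Γ = Gam₁ ∨ Γ = Gam₂) (hg : g ∈ Γ) (h1 : g ≠ 1) (hx : g x = x) :
    x ∈ verticalLines ∧ ∀ y i, g y i = sgn 2 i * y i + (x i - sgn 2 i * x i) := by
  have key : ∃ (m : Fin 3 → ℤ), ∀ x i, g x i = sgn 2 i * x i + 2 * m i := by
    rcases hΓ with rfl | rfl
    · obtain ⟨j, m, hm⟩ := (hasOffsets₁ g).1 hg
      fin_cases j
      · refine absurd (IsometryEquiv.ext fun y => ?_) h1
        ext i
        have h := hm x i
        have h' := hm y i
        rw [hx] at h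
        fin_cases i <;> simp [sgn, off₁] at h h' ⊢ <;> simp [h', h]
      · have h := hm x 1
        rw [hx] at h
        simp [sgn, off₁] at h
        have : (2 * m 1 + 1 : ℤ) = 0 := by exact_mod_cast h
        omega
      · exact ⟨m, fun y i => by rw [hm]; fin_cases i <;> simp [sgn, off₁]⟩
      · have h := hm x 0
        rw [hx] at h
        simp [sgn, off₁] at h
        have : (2 * m 0 + 1 : ℤ) = 0 := by exact_mod_cast h
        omega
    · obtain ⟨j, m, hm⟩ := (hasOffsets₂ g).1 hg
      fin_cases j
      · refine absurd (IsometryEquiv.ext fun y => ?_) h1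
        ext i
        have h := hm x i
        have h' := hm y i
        rw [hx] at h
        fin_cases i <;> simp [sgn, off₂] at h h' ⊢ <;> simp [h', h]
      · have h := hm x 2
        rw [hx] at h
        simp [sgn, off₂] at h
        have : (2 * m 2 + 1 : ℤ) = 0 := by exact_mod_cast h
        omega
      · exact ⟨m, fun y i => by rw [hm]; fin_cases i <;> simp [sgn, off₂]⟩
      · have h := hm x 2
        rw [hx] at h
        simp [sgn, off₂] at h
        have : (2 * m 2 + 1 : ℤ) = 0 := by exact_mod_cast h
        omega
  obtain ⟨m, hm⟩ := key
  refine ⟨⟨⟨m 0, ?_⟩, ⟨m 1, ?_⟩⟩, fun y i => ?_⟩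
  · have h := hm x 0
    rw [hx] at h
    simp [sgn] at h
    linarith
  · have h := hm x 1
    rw [hx] at h
    simp [sgn] at h
    linarith
  · have h := hm x i
    rw [hx] at h
    rw [hm]
    linarith

theorem exists_rotation {Γ : Subgroup (E 3 ≃ᵢ E 3)} (hΓ : Γ = Gam₁ ∨ Γ = Gam₂) {x : E 3}
    (hx : x ∈ verticalLines) :
    ∃ g ∈ Γ, ∀ y i, g y i = sgn 2 i * y i + (x i - sgn 2 i * x i) := by
  obtain ⟨⟨a, ha⟩, ⟨b, hb⟩⟩ := hx
  have key : ∃ g ∈ Γ, ∀ y i, g y i = sgn 2 i * y i + (2 * (![a, b, 0] i : ℤ) + (0 : ℤ)) := by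
    rcases hΓ with rfl | rfl
    · obtain ⟨g, hg, h⟩ := hasOffsets₁.exists_mem 2 ![a, b, 0]
      exact ⟨g, hg, fun y i => by rw [h]; fin_cases i <;> simp [off₁]⟩
    · obtain ⟨g, hg, h⟩ := hasOffsets₂.exists_mem 2 ![a, b, 0]
      exact ⟨g, hg, fun y i => by rw [h]; fin_cases i <;> simp [off₂]⟩
  obtain ⟨g, hg, h⟩ := key
  refine ⟨g, hg, fun y i => ?_⟩
  rw [h]
  fin_cases i <;> simp [sgn, ha, hb] <;> ring

theorem existsUnique_fixing {Γ : Subgroup (E 3 ≃ᵢ E 3)} (hΓ : Γ = Gam₁ ∨ Γ = Gam₂) {x : E 3}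
    (hx : x ∈ verticalLines) : ∃! g : E 3 ≃ᵢ E 3, g ∈ Γ ∧ g ≠ 1 ∧ g x = x := by
  obtain ⟨g, hg, h⟩ := exists_rotation hΓ hx
  refine ⟨g, ⟨hg, ?_, ?_⟩, ?_⟩
  · rintro rfl
    -- A point off the axis is moved by the half-turn, so it is not the identity.
    have := h (x + EuclideanSpace.single 0 1) 0
    simp [sgn] at this
    linarith
  · ext i
    rw [h]
    ring
  · rintro k ⟨hk, hk1, hkx⟩
    ext y i
    rw [h, (fixed_mem_verticalLines hΓ hk hk1 hkx).2]

theorem setOf_fixed_eq {Γ : Subgroup (E 3 ≃ᵢ E 3)} (hΓ : Γ = Gam₁ ∨ Γ = Gam₂) :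
    {x : E 3 | ∃ g ∈ Γ, g ≠ 1 ∧ g x = x} = verticalLines := by
  ext x
  constructor
  · rintro ⟨g, hg, h1, hx⟩
    exact (fixed_mem_verticalLines hΓ hg h1 hx).1
  · intro hx
    obtain ⟨g, ⟨hg, h1, hgx⟩, -⟩ := existsUnique_fixing hΓ hx
    exact ⟨g, hg, h1, hgx⟩

theorem nonempty_isotropy_equiv {Γ : Subgroup (E 3 ≃ᵢ E 3)} (hΓ : Γ = Gam₁ ∨ Γ = Gam₂) {x : E 3}
    (hx : x ∈ verticalLines) : Nonempty (isotropy Γ x ≃* Multiplicative (ZMod 2)) := by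
  obtain ⟨g, ⟨hg, h1, hgx⟩, huniq⟩ := existsUnique_fixing hΓ hx
  have hcard : Nat.card (isotropy Γ x) = 2 := by
    rw [Nat.card_eq_two_iff]
    refine ⟨1, ⟨⟨g, hg⟩, hgx⟩, ?_, ?_⟩
    · intro h
      exact h1 (congrArg (fun k : isotropy Γ x => (k : Γ).1) h).symm
    · refine Set.eq_univ_of_forall fun k => ?_
      by_cases hk : k = 1
      · exact Or.inl hk
      · refine Or.inr (Subtype.ext (Subtype.ext (huniq _ ⟨k.1.2, fun h => hk ?_, k.2⟩)))
        exact Subtype.ext (Subtype.ext h)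
  have : Fact (Nat.Prime 2) := ⟨Nat.prime_two⟩
  exact ⟨mulEquivOfPrimeCardEq hcard (by simp)⟩

theorem isotropy_ne_bot_iff {Γ : Subgroup (E 3 ≃ᵢ E 3)} (hΓ : Γ = Gam₁ ∨ Γ = Gam₂) (x : E 3) :
    isotropy Γ x ≠ ⊥ ↔ x ∈ verticalLines := by
  rw [← setOf_fixed_eq hΓ, Ne, Subgroup.eq_bot_iff_forall]
  push Not
  constructor
  · rintro ⟨g, hg, h1⟩
    exact ⟨g.1, g.2, fun h => h1 (Subtype.ext h), hg⟩
  · rintro ⟨g, hg, h1, hx⟩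
    exact ⟨⟨g, hg⟩, hx, fun h => h1 (congrArg Subtype.val h)⟩

/-! ### The fundamental domain -/

theorem box_eq_preimage :
    box = WithLp.ofLp ⁻¹' Set.pi Set.univ
      (fun i => Set.Icc (0 : ℝ) ((![1, 1, 2] : Fin 3 → ℝ) i)) := by
  ext x
  simp [box, Pi.le_def, Fin.forall_fin_succ]
  tauto

theorem interior_box :
    interior box = {x : E 3 | x 0 ∈ Set.Ioo (0 : ℝ) 1 ∧ x 1 ∈ Set.Ioo (0 : ℝ) 1 ∧
      x 2 ∈ Set.Ioo (0 : ℝ) 2} := by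
  have h := (PiLp.homeomorph 2 (fun _ : Fin 3 => ℝ)).preimage_interior
    (Set.pi Set.univ (fun i => Set.Icc (0 : ℝ) ((![1, 1, 2] : Fin 3 → ℝ) i)))
  have h2 : interior box = _ := (congrArg interior box_eq_preimage).trans h.symm
  rw [h2, interior_pi_set Set.finite_univ]
  ext x
  simp [Set.mem_pi, Fin.forall_fin_succ, PiLp.homeomorph]

theorem isCompact_box : IsCompact box := by
  rw [box_eq_preimage]
  exact (PiLp.homeomorph 2 (fun _ : Fin 3 => ℝ)).isCompact_preimage.2
    (isCompact_univ_pi fun i => isCompact_Icc)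

theorem exists_int_abs_sub_le (t : ℝ) : ∃ m : ℤ, t + 2 * m ∈ Set.Icc (-1 : ℝ) 1 := by
  refine ⟨-round (t / 2), ?_⟩
  have := abs_le.1 (abs_sub_round (t / 2))
  push_cast
  constructor <;> linarith [this.1, this.2]

theorem exists_int_mem_Icc (t : ℝ) : ∃ m : ℤ, t + 2 * m ∈ Set.Icc (0 : ℝ) 2 := by
  obtain ⟨m, hm⟩ := exists_int_abs_sub_le (t - 1)
  exact ⟨m, by constructor <;> linarith [hm.1, hm.2]⟩

/-- After reducing the first two coordinates to [-1, 1], their signs select the coset. When the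
signs differ, the offset 1 in both coordinates brings the point back into [0, 1]. -/
theorem exists_mem_box₁ (x : E 3) : ∃ g ∈ Gam₁, g x ∈ box := by
  obtain ⟨a, ha⟩ := exists_int_abs_sub_le (x 0)
  obtain ⟨b, hb⟩ := exists_int_abs_sub_le (x 1)
  obtain ⟨c, hc⟩ := exists_int_mem_Icc (x 2)
  obtain ⟨ha1, ha2⟩ := ha
  obtain ⟨hb1, hb2⟩ := hb
  rcases le_total 0 (x 0 + 2 * a) with h0 | h0 <;> rcases le_total 0 (x 1 + 2 * b) with h1 | h1
  · obtain ⟨g, hg, h⟩ := hasOffsets₁.exists_mem 0 ![a, b, c]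
    refine ⟨g, hg, ?_, ?_, ?_⟩ <;> rw [h] <;> simp [sgn, off₁, -Set.mem_Icc] <;>
      first | exact hc | constructor <;> linarith
  · obtain ⟨g, hg, h⟩ := hasOffsets₁.exists_mem 1 ![-a, b, c]
    refine ⟨g, hg, ?_, ?_, ?_⟩ <;> rw [h] <;> simp [sgn, off₁, -Set.mem_Icc] <;>
      first | exact hc | constructor <;> linarith
  · obtain ⟨g, hg, h⟩ := hasOffsets₁.exists_mem 3 ![a, -b, c]
    refine ⟨g, hg, ?_, ?_, ?_⟩ <;> rw [h] <;> simp [sgn, off₁, -Set.mem_Icc] <;>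
      first | exact hc | constructor <;> linarith
  · obtain ⟨g, hg, h⟩ := hasOffsets₁.exists_mem 2 ![-a, -b, c]
    refine ⟨g, hg, ?_, ?_, ?_⟩ <;> rw [h] <;> simp [sgn, off₁, -Set.mem_Icc] <;>
      first | exact hc | constructor <;> linarith

/-- Here negative coordinates are simply reflected. A single reflection costs a unit step in height,
so `d` is chosen for `x 2 + 1`. -/
theorem exists_mem_box₂ (x : E 3) : ∃ g ∈ Gam₂, g x ∈ box := by
  obtain ⟨a, ha⟩ := exists_int_abs_sub_le (x 0)
  obtain ⟨b, hb⟩ := exists_int_abs_sub_le (x 1)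
  obtain ⟨c, hc⟩ := exists_int_mem_Icc (x 2)
  obtain ⟨d, hd1, hd2⟩ := exists_int_mem_Icc (x 2 + 1)
  obtain ⟨ha1, ha2⟩ := ha
  obtain ⟨hb1, hb2⟩ := hb
  rcases le_total 0 (x 0 + 2 * a) with h0 | h0 <;> rcases le_total 0 (x 1 + 2 * b) with h1 | h1
  · obtain ⟨g, hg, h⟩ := hasOffsets₂.exists_mem 0 ![a, b, c]
    refine ⟨g, hg, ?_, ?_, ?_⟩ <;> rw [h] <;> simp [sgn, off₂, -Set.mem_Icc] <;>
      first | exact hc | constructor <;> linarith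
  · obtain ⟨g, hg, h⟩ := hasOffsets₂.exists_mem 3 ![a, -b, d]
    refine ⟨g, hg, ?_, ?_, ?_⟩ <;> rw [h] <;> simp [sgn, off₂, -Set.mem_Icc] <;>
      first | exact hc | constructor <;> linarith
  · obtain ⟨g, hg, h⟩ := hasOffsets₂.exists_mem 1 ![-a, b, d]
    refine ⟨g, hg, ?_, ?_, ?_⟩ <;> rw [h] <;> simp [sgn, off₂, -Set.mem_Icc] <;>
      first | exact hc | constructor <;> linarith
  · obtain ⟨g, hg, h⟩ := hasOffsets₂.exists_mem 2 ![-a, -b, c]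
    refine ⟨g, hg, ?_, ?_, ?_⟩ <;> rw [h] <;> simp [sgn, off₂, -Set.mem_Icc] <;>
      first | exact hc | constructor <;> linarith

/-- Two points of (0, 1) never differ by an odd integer, which excludes `j = 1, 3`, and their sum is
never even, which excludes `j = 2`. -/
theorem isClosedFundamentalDomain_box₁ : IsClosedFundamentalDomain Gam₁ box := by
  refine ⟨isCompact_box.isClosed, exists_mem_box₁, fun g hg h1 => ?_⟩
  rw [Set.disjoint_left]
  rintro _ ⟨x, hx, rfl⟩ hy
  rw [interior_box] at hx hy
  obtain ⟨⟨a0, a1⟩, ⟨a2, a3⟩, ⟨a4, a5⟩⟩ := hx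
  obtain ⟨⟨b0, b1⟩, ⟨b2, b3⟩, ⟨b4, b5⟩⟩ := hy
  obtain ⟨j, m, h⟩ := (hasOffsets₁ g).1 hg
  rw [h] at b0 b1 b2 b3 b4 b5
  fin_cases j
  · refine h1 (IsometryEquiv.ext fun y => ?_)
    simp [sgn, off₁] at b0 b1 b2 b3 b4 b5
    have l0 : (-1 : ℝ) < (2 * m 0 : ℤ) := by push_cast; linarith
    have u0 : ((2 * m 0 : ℤ) : ℝ) < 1 := by push_cast; linarith
    have l1 : (-1 : ℝ) < (2 * m 1 : ℤ) := by push_cast; linarith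
    have u1 : ((2 * m 1 : ℤ) : ℝ) < 1 := by push_cast; linarith
    have l2 : (-2 : ℝ) < (2 * m 2 : ℤ) := by push_cast; linarith
    have u2 : ((2 * m 2 : ℤ) : ℝ) < 2 := by push_cast; linarith
    norm_cast at l0 u0 l1 u1 l2 u2
    have e0 : m 0 = 0 := by omega
    have e1 : m 1 = 0 := by omega
    have e2 : m 2 = 0 := by omega
    ext i
    rw [h]
    fin_cases i <;> simp [sgn, off₁, e0, e1, e2]
  · simp [sgn, off₁] at b2 b3
    have l : (-1 : ℝ) < (2 * m 1 + 1 : ℤ) := by push_cast; linarith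
    have u : ((2 * m 1 + 1 : ℤ) : ℝ) < 1 := by push_cast; linarith
    norm_cast at l u
    omega
  · simp [sgn, off₁] at b0 b1
    have l : (0 : ℝ) < (2 * m 0 : ℤ) := by push_cast; linarith
    have u : ((2 * m 0 : ℤ) : ℝ) < 2 := by push_cast; linarith
    norm_cast at l u
    omega
  · simp [sgn, off₁] at b0 b1
    have l : (-1 : ℝ) < (2 * m 0 + 1 : ℤ) := by push_cast; linarith
    have u : ((2 * m 0 + 1 : ℤ) : ℝ) < 1 := by push_cast; linarith
    norm_cast at l u
    omega

/-- Every nontrivial `χ_j` reflects a horizontal coordinate with even offset, and two numbers of (0,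
1) never have an even sum. -/
theorem isClosedFundamentalDomain_box₂ : IsClosedFundamentalDomain Gam₂ box := by
  refine ⟨isCompact_box.isClosed, exists_mem_box₂, fun g hg h1 => ?_⟩
  rw [Set.disjoint_left]
  rintro _ ⟨x, hx, rfl⟩ hy
  rw [interior_box] at hx hy
  obtain ⟨⟨a0, a1⟩, ⟨a2, a3⟩, ⟨a4, a5⟩⟩ := hx
  obtain ⟨⟨b0, b1⟩, ⟨b2, b3⟩, ⟨b4, b5⟩⟩ := hy
  obtain ⟨j, m, h⟩ := (hasOffsets₂ g).1 hg
  rw [h] at b0 b1 b2 b3 b4 b5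
  fin_cases j
  · refine h1 (IsometryEquiv.ext fun y => ?_)
    simp [sgn, off₂] at b0 b1 b2 b3 b4 b5
    have l0 : (-1 : ℝ) < (2 * m 0 : ℤ) := by push_cast; linarith
    have u0 : ((2 * m 0 : ℤ) : ℝ) < 1 := by push_cast; linarith
    have l1 : (-1 : ℝ) < (2 * m 1 : ℤ) := by push_cast; linarith
    have u1 : ((2 * m 1 : ℤ) : ℝ) < 1 := by push_cast; linarith
    have l2 : (-2 : ℝ) < (2 * m 2 : ℤ) := by push_cast; linarith
    have u2 : ((2 * m 2 : ℤ) : ℝ) < 2 := by push_cast; linarith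
    norm_cast at l0 u0 l1 u1 l2 u2
    have e0 : m 0 = 0 := by omega
    have e1 : m 1 = 0 := by omega
    have e2 : m 2 = 0 := by omega
    ext i
    rw [h]
    fin_cases i <;> simp [sgn, off₂, e0, e1, e2]
  · simp [sgn, off₂] at b0 b1
    have l : (0 : ℝ) < (2 * m 0 : ℤ) := by push_cast; linarith
    have u : ((2 * m 0 : ℤ) : ℝ) < 2 := by push_cast; linarith
    norm_cast at l u
    omega
  · simp [sgn, off₂] at b0 b1
    have l : (0 : ℝ) < (2 * m 0 : ℤ) := by push_cast; linarith
    have u : ((2 * m 0 : ℤ) : ℝ) < 2 := by push_cast; linarith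
    norm_cast at l u
    omega
  · simp [sgn, off₂] at b2 b3
    have l : (0 : ℝ) < (2 * m 1 : ℤ) := by push_cast; linarith
    have u : ((2 * m 1 : ℤ) : ℝ) < 2 := by push_cast; linarith
    norm_cast at l u
    omega

/-! ### Discreteness and cocompactness -/

theorem continuous_isometryEquiv_apply {M : Type*} [PseudoMetricSpace M] (p : M) :
    Continuous fun g : M ≃ᵢ M => g p :=
  (continuous_eval_const (F := C(M, M)) p).comp
    (continuous_induced_dom (f := fun g : M ≃ᵢ M => (⟨g, g.continuous⟩ : C(M, M))))

/-- Evaluation at an interior point `p` of `D` is continuous, and `g` is the only element of the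
group that sends `p` into the open set `g (interior D)`. -/
theorem IsClosedFundamentalDomain.discreteTopology {M : Type*} [PseudoMetricSpace M]
    {Γ : Subgroup (M ≃ᵢ M)} {D : Set M} (h : IsClosedFundamentalDomain Γ D)
    (hD : (interior D).Nonempty) : DiscreteTopology Γ := by
  obtain ⟨p, hp⟩ := hD
  rw [discreteTopology_iff_isOpen_singleton]
  intro g
  have hopen : IsOpen ((fun k : Γ => k.1 p) ⁻¹' (g.1 '' interior D)) :=
    (g.1.toHomeomorph.isOpenMap _ isOpen_interior).preimage
      ((continuous_isometryEquiv_apply p).comp continuous_subtype_val)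
  convert hopen
  ext k
  constructor
  · rintro rfl
    exact ⟨p, hp, rfl⟩
  · rintro ⟨q, hq, hqp⟩
    by_contra hne
    refine Set.disjoint_left.1 (h.2.2 (g⁻¹ * k).1 (g⁻¹ * k).2 fun h1 => hne ?_) ⟨p, hp, rfl⟩ ?_
    · have : g⁻¹ * k = 1 := Subtype.ext h1
      rw [Set.mem_singleton_iff]
      exact (inv_mul_eq_one.1 this).symm
    · have : (g⁻¹ * k).1 p = g.1⁻¹ (k.1 p) := rfl
      have hqp' : g.1 q = k.1 p := hqp
      rw [this, ← hqp', IsometryEquiv.inv_apply_self]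
      exact hq

theorem isCompact_unitary {H : Type*} [NormedAddCommGroup H] [InnerProductSpace ℝ H]
    [FiniteDimensional ℝ H] [CompleteSpace H] :
    IsCompact (unitary (H →L[ℝ] H) : Set (H →L[ℝ] H)) := by
  have : ProperSpace (H →L[ℝ] H) := FiniteDimensional.proper ℝ _
  refine Metric.isCompact_of_isClosed_isBounded isClosed_unitary ?_
  refine isBounded_iff_forall_norm_le.2 ⟨1, fun u hu => ?_⟩
  refine ContinuousLinearMap.opNorm_le_bound _ zero_le_one fun x => ?_
  rw [one_mul]
  exact ((Unitary.linearIsometryEquiv ⟨u, hu⟩).norm_map x).le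

/-- Every coset has a representative that sends some point `d` of `D` to the origin, that is, a
translation by `-d` followed by an orthogonal map. So the quotient is a continuous image of the
compact space O(n) × D. -/
theorem compactSpace_quotient_of_isCompact {n : ℕ} {Γ : Subgroup (E n ≃ᵢ E n)} {D : Set (E n)}
    (hD : IsCompact D) (h : ∀ x, ∃ g ∈ Γ, g x ∈ D) : CompactSpace ((E n ≃ᵢ E n) ⧸ Γ) := by
  have : CompactSpace (unitary (E n →L[ℝ] E n)) := isCompact_iff_compactSpace.1 isCompact_unitary
  have : CompactSpace D := isCompact_iff_compactSpace.1 hD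
  let φ : unitary (E n →L[ℝ] E n) × D → (E n ≃ᵢ E n) := fun q =>
    (Unitary.linearIsometryEquiv q.1).toIsometryEquiv * transl (-q.2.1)
  have hφ : Continuous φ := by
    refine continuous_induced_rng.2 (ContinuousMap.continuous_of_continuous_uncurry _ ?_)
    have h1 : Continuous fun q : (unitary (E n →L[ℝ] E n) × D) × E n => q.1.1.1 :=
      continuous_subtype_val.comp (continuous_fst.comp continuous_fst)
    have h2 : Continuous fun q : (unitary (E n →L[ℝ] E n) × D) × E n => q.1.2.1 :=
      continuous_subtype_val.comp (continuous_snd.comp continuous_fst)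
    exact h1.clm_apply (continuous_snd.add h2.neg)
  have hsurj : Function.Surjective fun q => (φ q : (E n ≃ᵢ E n) ⧸ Γ) := by
    intro c
    induction c using QuotientGroup.induction_on with
    | H g =>
      obtain ⟨k, hk, hd⟩ := h (g⁻¹ 0)
      -- Another representative of the coset of `g`, sending the point `k (g⁻¹ 0)` of `D` to the
      -- origin.
      let g' := g * k⁻¹
      have hg' : g' (k (g⁻¹ 0)) = 0 := by
        simp only [g', IsometryEquiv.mul_apply, IsometryEquiv.inv_apply_self,
          IsometryEquiv.apply_inv_self]
      refine ⟨(Unitary.linearIsometryEquiv.symm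
        g'.toRealAffineIsometryEquiv.linearIsometryEquiv, ⟨k (g⁻¹ 0), hd⟩), ?_⟩
      have : φ (Unitary.linearIsometryEquiv.symm
          g'.toRealAffineIsometryEquiv.linearIsometryEquiv, ⟨k (g⁻¹ 0), hd⟩) = g' := by
        ext1 x
        simp only [φ, MulEquiv.apply_symm_apply, IsometryEquiv.mul_apply]
        have := g'.toRealAffineIsometryEquiv.map_vsub x (k (g⁻¹ 0))
        simp only [IsometryEquiv.coeFn_toRealAffineIsometryEquiv, hg', vsub_eq_sub, sub_zero] at this
        rw [← this, transl_apply, ← sub_eq_add_neg]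
        rfl
      simp only [this]
      rw [QuotientGroup.eq]
      simpa [g'] using hk
  exact hsurj.compactSpace (continuous_quot_mk.comp hφ)

theorem nonempty_interior_box : (interior box).Nonempty := by
  rw [interior_box]
  exact ⟨!₂[1 / 2, 1 / 2, 1], by refine ⟨?_, ?_, ?_⟩ <;> constructor <;> simp <;> norm_num⟩

theorem isCrystallographic₁ : IsCrystallographic Gam₁ :=
  ⟨isClosedFundamentalDomain_box₁.discreteTopology nonempty_interior_box,
    compactSpace_quotient_of_isCompact isCompact_box exists_mem_box₁⟩

theorem isCrystallographic₂ : IsCrystallographic Gam₂ :=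
  ⟨isClosedFundamentalDomain_box₂.discreteTopology nonempty_interior_box,
    compactSpace_quotient_of_isCompact isCompact_box exists_mem_box₂⟩

/-! ### Orientability -/

/-- An orientation field on the connected space ℝ³ is constant, whereas the elements with `j = 1`
have linear part of determinant -1. -/
theorem HasOffsets.not_orientable {Γ : Subgroup (E 3 ≃ᵢ E 3)} {c : Fin 4 → Fin 3 → ℤ}
    (h : HasOffsets Γ c) : ¬ Orientable Γ := by
  rintro ⟨o, hloc, ho⟩
  obtain ⟨g, hg, hgx⟩ := h.exists_mem 1 0
  have h1 := ho g hg 0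
  rw [hloc.apply_eq_of_preconnectedSpace (g 0) 0] at h1
  have hL : ∀ x i, g.toRealAffineIsometryEquiv.linearIsometryEquiv x i = sgn 1 i * x i := by
    intro x i
    have := g.toRealAffineIsometryEquiv.map_vsub x 0
    simp only [IsometryEquiv.coeFn_toRealAffineIsometryEquiv, vsub_eq_sub, sub_zero] at this
    rw [this, PiLp.sub_apply, hgx, hgx, PiLp.zero_apply]
    ring
  refine Module.Ray.ne_neg_self (o 0) (h1.symm.trans ?_)
  rw [Orientation.map_eq_neg_iff_det_neg _ _ (by simp)]
  rw [← LinearMap.det_toMatrix (EuclideanSpace.basisFun (Fin 3) ℝ).toBasis]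
  rw [Matrix.det_fin_three]
  simp [LinearMap.toMatrix_apply, hL, sgn]

/-! ### Orbit spaces -/

section OrbitSpace

variable {M : Type*} [PseudoMetricSpace M] {Γ : Subgroup (M ≃ᵢ M)}

theorem proj_eq_proj_iff {x y : M} : proj Γ x = proj Γ y ↔ ∃ g ∈ Γ, g x = y := by
  rw [proj, proj, Quotient.eq, MulAction.orbitRel_apply, MulAction.mem_orbit_iff]
  constructor
  · rintro ⟨g, hg⟩
    exact ⟨(g⁻¹).1, (g⁻¹).2, by rw [← hg]; exact IsometryEquiv.inv_apply_self g.1 y⟩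
  · rintro ⟨g, hg, rfl⟩
    exact ⟨⟨g⁻¹, Γ.inv_mem hg⟩, IsometryEquiv.inv_apply_self g x⟩

theorem proj_surjective : Function.Surjective (proj Γ) := Quotient.mk_surjective

theorem continuous_proj : Continuous (proj Γ) := continuous_quot_mk

theorem proj_apply_eq {g : M ≃ᵢ M} (hg : g ∈ Γ) (x : M) : proj Γ (g x) = proj Γ x :=
  (proj_eq_proj_iff.2 ⟨g, hg, rfl⟩).symm

theorem isOpenMap_proj : IsOpenMap (proj Γ) := by
  intro U hU
  have : proj Γ ⁻¹' (proj Γ '' U) = ⋃ g : Γ, g.1 '' U := by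
    ext x
    simp only [Set.mem_preimage, Set.mem_image, Set.mem_iUnion, proj_eq_proj_iff]
    constructor
    · rintro ⟨y, hy, g, hg, rfl⟩
      exact ⟨⟨g, hg⟩, y, hy, rfl⟩
    · rintro ⟨g, y, hy, rfl⟩
      exact ⟨y, hy, g.1, g.2, rfl⟩
  have hq : Topology.IsQuotientMap (proj Γ) := isQuotientMap_quot_mk
  rw [← hq.isOpen_preimage, this]
  exact isOpen_iUnion fun g => g.1.toHomeomorph.isOpenMap U hU

theorem compactSpace_orbitSpace {D : Set M} (hD : IsCompact D) (h : ∀ x, ∃ g ∈ Γ, g x ∈ D) :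
    CompactSpace (OrbitSpace Γ) := by
  refine ⟨?_⟩
  convert hD.image continuous_proj
  symm
  refine Set.eq_univ_of_forall fun p => ?_
  obtain ⟨x, rfl⟩ := proj_surjective p
  obtain ⟨g, hg, hx⟩ := h x
  exact ⟨g x, hx, proj_apply_eq hg x⟩

end OrbitSpace

/-! ### The underlying space of the first orbifold -/

/-- The matrix of products `v i * v j` depends continuously on the line and determines `v` up to
sign. -/
instance : T2Space ProjectivePlane := by
  let f : ProjectivePlane → Fin 3 → Fin 3 → ℝ := Quotient.lift (s := antipodal)
    (fun (v : Metric.sphere (0 : E 3) 1) i j => v.1 i * v.1 j) (by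
      rintro a b (rfl | rfl)
      · rfl
      · funext i j
        simp)
  refine T2Space.of_injective_continuous (f := f) ?_ ?_
  · rintro ⟨a⟩ ⟨b⟩ hab
    have h : ∀ i j, a.1 i * a.1 j = b.1 i * b.1 j := fun i j => congrFun (congrFun hab i) j
    refine Quotient.sound (s := antipodal) ?_
    have hne : ∃ i, a.1 i ≠ 0 := by
      by_contra! h0
      have : a.1 = 0 := by ext i; exact h0 i
      exact ne_zero_of_mem_unit_sphere a this
    obtain ⟨i, hi⟩ := hne
    rcases mul_self_eq_mul_self_iff.1 (h i i) with h1 | h1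
    · refine Or.inl (Subtype.ext (PiLp.ext fun j => mul_left_cancel₀ hi ?_))
      rw [h, h1]
    · refine Or.inr (Subtype.ext (PiLp.ext fun j => mul_left_cancel₀ hi ?_))
      rw [h, h1]
      simp
  · refine Continuous.quotient_lift (s := antipodal) ?_ _
    fun_prop

/-- An equation of the surface of the pillow, a sphere around the origin. -/
def pillowSurface : Set (E 3) :=
  {p | p 0 ^ 2 ≤ 1 ∧ p 1 ^ 2 ≤ 1 ∧ p 2 ^ 2 = (1 - p 0 ^ 2) * (1 - p 1 ^ 2)}

/-- Together with its reciprocal version this shows that a ray from the origin meets the surface at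
most once. -/
theorem not_lt_one_of_smul_mem {p : E 3} {t : ℝ} (ht : 0 < t) (hp : p ∈ pillowSurface)
    (htp : t • p ∈ pillowSurface) : ¬ t < 1 := by
  intro h1
  obtain ⟨hA, hB, hC⟩ := hp
  obtain ⟨-, -, hC'⟩ := htp
  simp only [PiLp.smul_apply, smul_eq_mul, mul_pow] at hC'
  rw [hC] at hC'
  have hs0 : 0 < t ^ 2 := by positivity
  have hs1 : t ^ 2 < 1 := by nlinarith
  generalize t ^ 2 = s at *
  have hA0 := sq_nonneg (p 0)
  have hB0 := sq_nonneg (p 1)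
  generalize p 0 ^ 2 = A at *
  generalize p 1 ^ 2 = B at *
  have hpos : 0 < 1 - s * B := by nlinarith
  -- With `A`, `B` the squares of the first two coordinates, (1 - sA)(1 - sB) exceeds s(1 - A)(1 -
  -- B) by the sum of the quantities in `h2` and `h3`, so the two cannot be equal.
  have h2 : 0 < (1 - s) * (1 - s * B) := mul_pos (by linarith) hpos
  have h3 : 0 ≤ s * (1 - A) * ((1 - s) * B) := by
    have : 0 ≤ 1 - A := by linarith
    have : 0 ≤ 1 - s := by linarith
    positivity
  nlinarith

theorem eq_of_smul_mem_pillowSurface {p : E 3} {t : ℝ} (ht : 0 < t) (hp : p ∈ pillowSurface)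
    (htp : t • p ∈ pillowSurface) : t = 1 := by
  refine le_antisymm (not_lt.1 fun h => ?_) (not_lt.1 (not_lt_one_of_smul_mem ht hp htp))
  refine not_lt_one_of_smul_mem (p := t • p) (inv_pos.2 ht) htp ?_ (inv_lt_one_of_one_lt₀ h)
  rwa [smul_smul, inv_mul_cancel₀ ht.ne', one_smul]

/-- The equation involves only squares, so the unknown is the square `s` of the scaling factor. Off
the vertical axis the intermediate value theorem applies on [0, 1/K], where `K` is the larger of the
first two squares: the defect `f` is 1 at 0 and nonpositive at 1/K. -/
theorem exists_smul_mem_pillowSurface {p : E 3} (hp : p ≠ 0) :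
    ∃ t : ℝ, 0 < t ∧ t • p ∈ pillowSurface := by
  obtain ⟨s, hs, h1, h2, h3⟩ : ∃ s : ℝ, 0 < s ∧ s * p 0 ^ 2 ≤ 1 ∧ s * p 1 ^ 2 ≤ 1 ∧
      s * p 2 ^ 2 = (1 - s * p 0 ^ 2) * (1 - s * p 1 ^ 2) := by
    rcases (le_max_of_le_left (sq_nonneg (p 0)) : 0 ≤ max (p 0 ^ 2) (p 1 ^ 2)).eq_or_lt with h | h
    · have h0 : p 0 ^ 2 = 0 := le_antisymm (h ▸ le_max_left _ _) (sq_nonneg _)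
      have h1 : p 1 ^ 2 = 0 := le_antisymm (h ▸ le_max_right _ _) (sq_nonneg _)
      have h2 : p 2 ≠ 0 := by
        intro h2
        refine hp (PiLp.ext fun i => ?_)
        rw [pow_eq_zero_iff two_ne_zero] at h0 h1
        fin_cases i <;> simp [h0, h1, h2]
      refine ⟨(p 2 ^ 2)⁻¹, by positivity, ?_, ?_, ?_⟩ <;> simp [h0, h1, h2]
    · set K := max (p 0 ^ 2) (p 1 ^ 2) with hK
      let f : ℝ → ℝ := fun s => (1 - s * p 0 ^ 2) * (1 - s * p 1 ^ 2) - s * p 2 ^ 2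
      have hend : f K⁻¹ ≤ 0 := by
        have : (1 - K⁻¹ * p 0 ^ 2) * (1 - K⁻¹ * p 1 ^ 2) = 0 := by
          rcases max_choice (p 0 ^ 2) (p 1 ^ 2) with h' | h'
          · rw [← h', ← hK, inv_mul_cancel₀ h.ne']; simp
          · rw [← h', ← hK, inv_mul_cancel₀ h.ne']; simp
        simp only [f, this, zero_sub, neg_nonpos]
        positivity
      obtain ⟨s, ⟨hs0, hs1⟩, hs⟩ := intermediate_value_Icc' (inv_nonneg.2 h.le)
        (f := f) (by fun_prop) (show (0 : ℝ) ∈ _ from ⟨hend, by simp [f]⟩)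
      have hsK : s * K ≤ 1 := by
        calc s * K ≤ K⁻¹ * K := by gcongr
          _ = 1 := inv_mul_cancel₀ h.ne'
      refine ⟨s, hs0.lt_of_ne ?_, ?_, ?_, ?_⟩
      · rintro rfl
        simp [f] at hs
      · exact (mul_le_mul_of_nonneg_left (le_max_left _ _) hs0).trans hsK
      · exact (mul_le_mul_of_nonneg_left (le_max_right _ _) hs0).trans hsK
      · exact (sub_eq_zero.1 hs).symm
  refine ⟨√s, Real.sqrt_pos.2 hs, ?_, ?_, ?_⟩ <;>
    simp only [PiLp.smul_apply, smul_eq_mul, mul_pow, Real.sq_sqrt hs.le] <;> assumption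

/-- The pillow: the map `ℝ² → ℝ³` which parametrizes the surface of the pillow. -/
noncomputable def pillow (x : E 3) : E 3 :=
  !₂[Real.cos (Real.pi * x 0), Real.cos (Real.pi * x 1),
    Real.sin (Real.pi * x 0) * Real.sin (Real.pi * x 1)]

theorem continuous_pillow : Continuous pillow := by
  unfold pillow
  fun_prop

theorem pillow_mem (x : E 3) : pillow x ∈ pillowSurface := by
  refine ⟨?_, ?_, ?_⟩
  · simp [pillow, Real.abs_cos_le_one]
  · simp [pillow, Real.abs_cos_le_one]
  · simp [pillow, mul_pow, Real.sin_sq]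

theorem pillow_ne_zero (x : E 3) : pillow x ≠ 0 := by
  intro h
  have := (pillow_mem x).2.2
  rw [h] at this
  simp at this

theorem cos_pi_mul_add (t : ℝ) (m : ℤ) :
    Real.cos (Real.pi * (t + 2 * m)) = Real.cos (Real.pi * t) := by
  rw [← Real.cos_add_int_mul_two_pi (Real.pi * t) m]
  ring_nf

theorem sin_pi_mul_add (t : ℝ) (m : ℤ) :
    Real.sin (Real.pi * (t + 2 * m)) = Real.sin (Real.pi * t) := by
  rw [← Real.sin_add_int_mul_two_pi (Real.pi * t) m]
  ring_nf

theorem exists_of_cos_pi_mul_eq {a b : ℝ} (h : Real.cos (Real.pi * a) = Real.cos (Real.pi * b)) :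
    ∃ m : ℤ, b = a + 2 * m ∨ b = -a + 2 * m := by
  obtain ⟨m, hm | hm⟩ := Real.cos_eq_cos_iff.1 h
  · exact ⟨m, Or.inl (mul_left_cancel₀ Real.pi_ne_zero (by rw [hm]; ring))⟩
  · exact ⟨m, Or.inr (mul_left_cancel₀ Real.pi_ne_zero (by rw [hm]; ring))⟩

theorem exists_int_of_sin_pi_mul_eq_zero {a : ℝ} (h : Real.sin (Real.pi * a) = 0) :
    ∃ m : ℤ, a = m := by
  obtain ⟨m, hm⟩ := Real.sin_eq_zero_iff.1 h
  exact ⟨m, mul_left_cancel₀ Real.pi_ne_zero (by rw [← hm]; ring)⟩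

/-- The cosines determine each coordinate up to sign and even integers. The product of sines
excludes mixed signs unless a sine vanishes; then that coordinate is an integer `k`, and `k` and
`-k` agree modulo two. -/
theorem exists_of_pillow_eq {x y : E 3} (h : pillow x = pillow y) :
    ∃ m n : ℤ, (y 0 = x 0 + 2 * m ∧ y 1 = x 1 + 2 * n) ∨
      (y 0 = -x 0 + 2 * m ∧ y 1 = -x 1 + 2 * n) := by
  have h0 : Real.cos (Real.pi * x 0) = Real.cos (Real.pi * y 0) := congrArg (fun p : E 3 => p 0) h
  have h1 : Real.cos (Real.pi * x 1) = Real.cos (Real.pi * y 1) := congrArg (fun p : E 3 => p 1) h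
  have h2 : Real.sin (Real.pi * x 0) * Real.sin (Real.pi * x 1) =
    Real.sin (Real.pi * y 0) * Real.sin (Real.pi * y 1) := congrArg (fun p : E 3 => p 2) h
  obtain ⟨m, hm⟩ := exists_of_cos_pi_mul_eq h0
  obtain ⟨n, hn⟩ := exists_of_cos_pi_mul_eq h1
  have zero : Real.sin (Real.pi * x 0) * Real.sin (Real.pi * x 1) =
      -(Real.sin (Real.pi * x 0) * Real.sin (Real.pi * x 1)) →
      (∃ k : ℤ, x 0 = k) ∨ ∃ k : ℤ, x 1 = k := by
    intro h
    rcases mul_eq_zero.1 (self_eq_neg.1 h) with h | h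
    · exact Or.inl (exists_int_of_sin_pi_mul_eq_zero h)
    · exact Or.inr (exists_int_of_sin_pi_mul_eq_zero h)
  rcases hm with hm | hm <;> rcases hn with hn | hn
  · exact ⟨m, n, Or.inl ⟨hm, hn⟩⟩
  · rw [hm, hn, sin_pi_mul_add, sin_pi_mul_add, mul_neg, Real.sin_neg, mul_neg] at h2
    rcases zero h2 with ⟨k, hk⟩ | ⟨k, hk⟩
    · exact ⟨m + k, n, Or.inr ⟨by rw [hm, hk]; push_cast; ring, hn⟩⟩
    · exact ⟨m, n - k, Or.inl ⟨hm, by rw [hn, hk]; push_cast; ring⟩⟩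
  · rw [hm, hn, sin_pi_mul_add, sin_pi_mul_add, mul_neg, Real.sin_neg, neg_mul] at h2
    rcases zero h2 with ⟨k, hk⟩ | ⟨k, hk⟩
    · exact ⟨m - k, n, Or.inl ⟨by rw [hm, hk]; push_cast; ring, hn⟩⟩
    · exact ⟨m, n + k, Or.inr ⟨hm, by rw [hn, hk]; push_cast; ring⟩⟩
  · exact ⟨m, n, Or.inr ⟨hm, hn⟩⟩

theorem exists_pillow_eq {p : E 3} (hp : p ∈ pillowSurface) (z : ℝ) :
    ∃ x : E 3, pillow x = p ∧ x 2 = z := by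
  obtain ⟨h0, h1, h2⟩ := hp
  have hcos : ∀ {a : ℝ}, a ^ 2 ≤ 1 → Real.cos (Real.pi * (Real.arccos a / Real.pi)) = a := by
    intro a ha
    rw [mul_div_cancel₀ _ Real.pi_ne_zero]
    have := abs_le.1 ((sq_le_one_iff_abs_le_one a).1 ha)
    exact Real.cos_arccos this.1 this.2
  have c0 := hcos h0
  have c1 := hcos h1
  set a := Real.arccos (p 0) / Real.pi
  set b := Real.arccos (p 1) / Real.pi
  have hs : (Real.sin (Real.pi * a) * Real.sin (Real.pi * b)) ^ 2 = p 2 ^ 2 := by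
    rw [mul_pow, Real.sin_sq, Real.sin_sq, c0, c1, h2]
  rcases sq_eq_sq_iff_eq_or_eq_neg.1 hs with hs | hs
  · refine ⟨!₂[a, b, z], ?_, rfl⟩
    ext i
    fin_cases i <;> simp [pillow, c0, c1, hs]
  -- Reversing `a` keeps the cosines and changes the sign of the third coordinate.
  · refine ⟨!₂[-a, b, z], ?_, rfl⟩
    ext i
    fin_cases i <;> simp [pillow, c0, c1, hs]

/-- The reparametrization of the pillow by which the nontrivial cosets in `Γ₁` of the rotations and
translations act as the antipodal map. -/
theorem pillow_smul (x : E 3) {g : E 3 ≃ᵢ E 3} (hg : g ∈ Gam₁) :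
    pillow (g x) = pillow x ∨ pillow (g x) = -pillow x := by
  obtain ⟨j, m, h⟩ := (hasOffsets₁ g).1 hg
  have h' : ∀ i, g x i = (sgn j i * x i + off₁ j i) + 2 * m i := fun i => by rw [h]; ring
  have e0 := (congrArg (fun t => Real.cos (Real.pi * t)) (h' 0)).trans (cos_pi_mul_add _ _)
  have e1 := (congrArg (fun t => Real.cos (Real.pi * t)) (h' 1)).trans (cos_pi_mul_add _ _)
  have e2 := (congrArg (fun t => Real.sin (Real.pi * t)) (h' 0)).trans (sin_pi_mul_add _ _)
  have e3 := (congrArg (fun t => Real.sin (Real.pi * t)) (h' 1)).trans (sin_pi_mul_add _ _)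
  dsimp only at e0 e1 e2 e3
  fin_cases j
  · left
    ext i
    fin_cases i <;> simp [pillow, e0, e1, e2, e3, sgn, off₁]
  · right
    ext i
    fin_cases i <;> simp [pillow, e0, e1, e2, e3, sgn, off₁, mul_add, Real.cos_add, Real.sin_add]
  · left
    ext i
    fin_cases i <;> simp [pillow, e0, e1, e2, e3, sgn, off₁]
  · right
    ext i
    fin_cases i <;> simp [pillow, e0, e1, e2, e3, sgn, off₁, mul_add, Real.cos_add, Real.sin_add]

theorem exists_mem_Gam₁_of_pillow {x y : E 3} (h : pillow x = pillow y ∨ pillow x = -pillow y)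
    {k : ℤ} (hk : y 2 = x 2 + 2 * k) : ∃ g ∈ Gam₁, g x = y := by
  have key : ∀ {x : E 3}, pillow x = pillow y → y 2 = x 2 + 2 * k → ∃ g ∈ Gam₁, g x = y := by
    intro x h hk
    obtain ⟨m, n, ⟨hm, hn⟩ | ⟨hm, hn⟩⟩ := exists_of_pillow_eq h
    · obtain ⟨g, hg, hgx⟩ := hasOffsets₁.exists_mem 0 ![m, n, k]
      refine ⟨g, hg, PiLp.ext fun i => ?_⟩
      rw [hgx]
      fin_cases i <;> simp [sgn, off₁, hm, hn, hk]
    · obtain ⟨g, hg, hgx⟩ := hasOffsets₁.exists_mem 2 ![m, n, k]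
      refine ⟨g, hg, PiLp.ext fun i => ?_⟩
      rw [hgx]
      fin_cases i <;> simp [sgn, off₁, hm, hn, hk]
  rcases h with h | h
  · exact key h hk
  -- The element `r` realizes the antipodal map of the pillow without changing the height, which
  -- reduces this case to the previous one.
  · obtain ⟨r, hr, hrx⟩ := hasOffsets₁.exists_mem 1 0
    have hr2 : r x 2 = x 2 := by simp [hrx, sgn, off₁]
    have hrp : pillow (r x) = pillow y := by
      rw [← neg_eq_iff_eq_neg] at h
      rw [← h]
      ext i
      fin_cases i <;> simp [pillow, hrx, sgn, off₁, mul_add, Real.cos_add, Real.sin_add]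
    obtain ⟨g, hg, hgx⟩ := key hrp (by rw [hr2, hk])
    exact ⟨g * r, Subgroup.mul_mem _ hg hr, hgx⟩

/-- The radial projection of the pillow to the unit sphere. -/
noncomputable def pillowSphere (x : E 3) : Metric.sphere (0 : E 3) 1 :=
  ⟨‖pillow x‖⁻¹ • pillow x, by
    rw [mem_sphere_zero_iff_norm, norm_smul, norm_inv, norm_norm,
      inv_mul_cancel₀ (norm_ne_zero_iff.2 (pillow_ne_zero x))]⟩

theorem continuous_pillowSphere : Continuous pillowSphere :=
  ((continuous_pillow.norm.inv₀ fun x => norm_ne_zero_iff.2 (pillow_ne_zero x)).smul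
    continuous_pillow).subtype_mk _

/-- Points of the surface on the same ray coincide, so radial projection to the sphere loses no
information. -/
theorem pillow_eq_of_smul_eq {p q : E 3} (hp : p ∈ pillowSurface) (hq : q ∈ pillowSurface)
    {s t : ℝ} (hs : 0 < s) (ht : 0 < t) (h : s • p = t • q) : p = q := by
  have h1 : p = (s⁻¹ * t) • q := by rw [mul_smul, ← h, smul_smul, inv_mul_cancel₀ hs.ne', one_smul]
  rw [eq_of_smul_mem_pillowSurface (mul_pos (inv_pos.2 hs) ht) hq (h1 ▸ hp), one_smul] at h1
  exact h1

theorem neg_mem_pillowSurface {p : E 3} (hp : p ∈ pillowSurface) : -p ∈ pillowSurface := by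
  simpa [pillowSurface] using hp

theorem pillowSphere_rel_iff (x y : E 3) :
    (pillowSphere x = pillowSphere y ∨ pillowSphere x = -pillowSphere y) ↔
      (pillow x = pillow y ∨ pillow x = -pillow y) := by
  have hpos : ∀ x, 0 < ‖pillow x‖⁻¹ := fun x => inv_pos.2 (norm_pos_iff.2 (pillow_ne_zero x))
  refine or_congr ⟨fun h => ?_, fun h => ?_⟩ ⟨fun h => ?_, fun h => ?_⟩
  · exact pillow_eq_of_smul_eq (pillow_mem x) (pillow_mem y) (hpos x) (hpos y)
      (congrArg Subtype.val h)
  · exact Subtype.ext (by simp only [pillowSphere, h])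
  · refine pillow_eq_of_smul_eq (pillow_mem x) (neg_mem_pillowSurface (pillow_mem y)) (hpos x)
      (hpos y) ?_
    rw [smul_neg]
    exact congrArg Subtype.val h
  · refine Subtype.ext ?_
    change ‖pillow x‖⁻¹ • pillow x = -(‖pillow y‖⁻¹ • pillow y)
    rw [h, norm_neg, smul_neg]

/-- The map `ℝ³ → ℝP² × S¹` inducing the homeomorphism with the first orbifold. -/
noncomputable def toProjectiveCircle (x : E 3) : ProjectivePlane × Circle :=
  (Quotient.mk antipodal (pillowSphere x), Circle.exp (Real.pi * x 2))

theorem continuous_toProjectiveCircle : Continuous toProjectiveCircle := by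
  refine (continuous_quot_mk.comp continuous_pillowSphere).prodMk ?_
  exact Circle.exp.continuous.comp (by fun_prop)

theorem toProjectiveCircle_eq_iff (x y : E 3) :
    toProjectiveCircle x = toProjectiveCircle y ↔ ∃ g ∈ Gam₁, g x = y := by
  rw [toProjectiveCircle, toProjectiveCircle, Prod.mk.injEq, Quotient.eq]
  change (pillowSphere x = pillowSphere y ∨ pillowSphere x = -pillowSphere y) ∧ _ ↔ _
  rw [pillowSphere_rel_iff, Circle.exp_eq_exp]
  constructor
  · rintro ⟨h, m, hm⟩
    refine exists_mem_Gam₁_of_pillow (k := -m) h (mul_left_cancel₀ Real.pi_ne_zero ?_)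
    push_cast
    linarith
  · rintro ⟨g, hg, rfl⟩
    refine ⟨?_, ?_⟩
    · rcases pillow_smul x hg with h | h
      · exact Or.inl h.symm
      · exact Or.inr (by rw [h, neg_neg])
    · obtain ⟨j, m, h⟩ := (hasOffsets₁ g).1 hg
      refine ⟨-m 2, ?_⟩
      rw [h]
      fin_cases j <;> simp [sgn, off₁] <;> ring

theorem toProjectiveCircle_surjective : Function.Surjective toProjectiveCircle := by
  rintro ⟨⟨v⟩, c⟩
  obtain ⟨t, ht, hv⟩ := exists_smul_mem_pillowSurface (ne_zero_of_mem_unit_sphere v)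
  obtain ⟨x, hx, hx2⟩ := exists_pillow_eq hv (Complex.arg c / Real.pi)
  refine ⟨x, Prod.ext (congrArg (Quotient.mk antipodal) (Subtype.ext ?_)) ?_⟩
  · change ‖pillow x‖⁻¹ • pillow x = v.1
    rw [hx, norm_smul, mem_sphere_zero_iff_norm.1 v.2, mul_one, Real.norm_of_nonneg ht.le, smul_smul,
      inv_mul_cancel₀ ht.ne', one_smul]
  · change Circle.exp (Real.pi * x 2) = c
    rw [hx2, mul_div_cancel₀ _ Real.pi_ne_zero, Circle.exp_arg]

/-- The fibres of `toProjectiveCircle` are exactly the orbits, so it induces a continuous bijection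
from a compact space to a Hausdorff space. -/
theorem nonempty_homeomorph_projectivePlane_prod_circle :
    Nonempty (OrbitSpace Gam₁ ≃ₜ ProjectivePlane × Circle) := by
  have := compactSpace_orbitSpace isCompact_box exists_mem_box₁
  let f : OrbitSpace Gam₁ → ProjectivePlane × Circle := Quotient.lift toProjectiveCircle
    fun x y hxy => (toProjectiveCircle_eq_iff x y).2 (proj_eq_proj_iff.1 (Quotient.sound hxy))
  have hf : Continuous f := continuous_toProjectiveCircle.quotient_lift _
  refine ⟨Continuous.homeoOfEquivCompactToT2 (f := Equiv.ofBijective f ⟨?_, ?_⟩) hf⟩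
  · rintro ⟨x⟩ ⟨y⟩ h
    exact proj_eq_proj_iff.2 ((toProjectiveCircle_eq_iff x y).1 h)
  · intro q
    obtain ⟨x, hx⟩ := toProjectiveCircle_surjective q
    exact ⟨proj Gam₁ x, hx⟩

/-! ### Isometries of the torus induced by isometries of `ℝⁿ` -/

section Torus

variable {n : ℕ} {Λ : AddSubgroup (E n)}

theorem Induces.unique {g : E n ≃ᵢ E n} {h k : Torus Λ ≃ᵢ Torus Λ} (hh : Induces g h)
    (hk : Induces g k) : h = k := by
  ext p
  induction p using QuotientAddGroup.induction_on with
  | H x => rw [hh, hk]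

theorem Induces.mul {g₁ g₂ : E n ≃ᵢ E n} {h₁ h₂ : Torus Λ ≃ᵢ Torus Λ} (hh₁ : Induces g₁ h₁)
    (hh₂ : Induces g₂ h₂) : Induces (g₁ * g₂) (h₁ * h₂) := fun x => by
  rw [IsometryEquiv.mul_apply, hh₂, hh₁, IsometryEquiv.mul_apply]

/-- The isometry `g` permutes the cosets of `Λ`. -/
def MapsCosets (Λ : AddSubgroup (E n)) (g : E n ≃ᵢ E n) : Prop :=
  ∀ x, ∀ v ∈ Λ, g (x + v) - g x ∈ Λ

/-- The map of the torus induced by `g`. -/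
noncomputable def MapsCosets.map {g : E n ≃ᵢ E n} (hg : MapsCosets Λ g) (p : Torus Λ) : Torus Λ :=
  Quotient.map' (s₁ := QuotientAddGroup.leftRel Λ) (s₂ := QuotientAddGroup.leftRel Λ) g (by
    intro x y hxy
    rw [QuotientAddGroup.leftRel_apply] at hxy ⊢
    have := hg x _ hxy
    rwa [add_neg_cancel_left, sub_eq_neg_add] at this) p

theorem MapsCosets.map_mk {g : E n ≃ᵢ E n} (hg : MapsCosets Λ g) (x : E n) :
    hg.map (QuotientAddGroup.mk x) = QuotientAddGroup.mk (g x) := rfl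

/-- The quotient norm is an infimum over representatives of a difference; `g` carries such a
representative to one of the same length. -/
theorem MapsCosets.dist_map_le {g : E n ≃ᵢ E n} (hg : MapsCosets Λ g) (p q : Torus Λ) :
    dist (hg.map p) (hg.map q) ≤ dist p q := by
  induction p using QuotientAddGroup.induction_on with
  | H x =>
  induction q using QuotientAddGroup.induction_on with
  | H y =>
  refine le_of_forall_gt fun r hr => ?_
  rw [dist_eq_norm, ← QuotientAddGroup.mk_sub, QuotientAddGroup.norm_lt_iff] at hr
  obtain ⟨w, hw, hwr⟩ := hr
  have hv : w - (x - y) ∈ Λ := by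
    rw [QuotientAddGroup.eq] at hw
    rw [← neg_mem_iff]
    convert hw using 1
    abel
  rw [hg.map_mk, hg.map_mk, dist_eq_norm, ← QuotientAddGroup.mk_sub, QuotientAddGroup.norm_lt_iff]
  refine ⟨g (x + (w - (x - y))) - g y, ?_, ?_⟩
  · rw [QuotientAddGroup.eq, ← neg_mem_iff]
    convert hg x _ hv using 1
    abel
  · rw [← dist_eq_norm, g.dist_eq, dist_eq_norm]
    convert hwr using 2
    abel

/-- The maps induced by `g` and `g⁻¹` are mutually inverse and both nonexpanding, hence isometries.
-/
theorem MapsCosets.exists_induces {g : E n ≃ᵢ E n} (hg : MapsCosets Λ g)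
    (hg' : MapsCosets Λ g⁻¹) : ∃ h : Torus Λ ≃ᵢ Torus Λ, Induces g h := by
  have h1 : ∀ p, hg'.map (hg.map p) = p := by
    intro p
    induction p using QuotientAddGroup.induction_on with
    | H x => rw [hg.map_mk, hg'.map_mk, IsometryEquiv.inv_apply_self]
  have h2 : ∀ p, hg.map (hg'.map p) = p := by
    intro p
    induction p using QuotientAddGroup.induction_on with
    | H x => rw [hg'.map_mk, hg.map_mk, IsometryEquiv.apply_inv_self]
  refine ⟨⟨⟨hg.map, hg'.map, h1, h2⟩, Isometry.of_dist_eq fun p q => ?_⟩, fun x => rfl⟩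
  refine le_antisymm (hg.dist_map_le p q) ?_
  calc dist p q = dist (hg'.map (hg.map p)) (hg'.map (hg.map q)) := by rw [h1, h1]
    _ ≤ _ := hg'.dist_map_le _ _

theorem inducedGroup_mono {Γ Γ' : Subgroup (E n ≃ᵢ E n)} (h : Γ ≤ Γ') :
    inducedGroup Λ Γ ≤ inducedGroup Λ Γ' := by
  rintro k ⟨g, hg, hgk⟩
  exact ⟨g, h hg, hgk⟩

/-- The quotient of the torus by the induced group is homeomorphic to `Γ \ ℝⁿ`. -/
theorem exists_homeomorph_inducedGroup {Γ : Subgroup (E n ≃ᵢ E n)} (hΛ : ∀ v ∈ Λ, transl v ∈ Γ)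
    (hΓ : ∀ g ∈ Γ, ∃ h : Torus Λ ≃ᵢ Torus Λ, Induces g h) :
    ∃ f : OrbitSpace Γ ≃ₜ OrbitSpace (inducedGroup Λ Γ), ∀ x : E n,
      f (proj Γ x) = proj (inducedGroup Λ Γ) (QuotientAddGroup.mk x) := by
  have key : ∀ x y : E n, proj (inducedGroup Λ Γ) (QuotientAddGroup.mk x) =
      proj (inducedGroup Λ Γ) (QuotientAddGroup.mk y) ↔ proj Γ x = proj Γ y := by
    intro x y
    rw [proj_eq_proj_iff, proj_eq_proj_iff]
    constructor
    · rintro ⟨h, ⟨g, hg, hgh⟩, hxy⟩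
      rw [hgh, QuotientAddGroup.eq] at hxy
      -- Equality on the torus holds only modulo `Λ`; the missing lattice translation belongs to
      -- `Γ`.
      refine ⟨transl (-g x + y) * g, Γ.mul_mem (hΛ _ hxy) hg, ?_⟩
      rw [IsometryEquiv.mul_apply, transl_apply, add_neg_cancel_left]
    · rintro ⟨g, hg, rfl⟩
      obtain ⟨h, hgh⟩ := hΓ g hg
      exact ⟨h, ⟨g, hg, hgh⟩, hgh x⟩
  let f : OrbitSpace Γ → OrbitSpace (inducedGroup Λ Γ) := Quotient.lift
    (fun x => proj (inducedGroup Λ Γ) (QuotientAddGroup.mk x))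
    fun x y hxy => (key x y).2 (Quotient.sound hxy)
  have hf : Continuous f := (continuous_proj.comp continuous_quot_mk).quotient_lift _
  have hopen : IsOpenMap f := by
    intro U hU
    have : f '' U = proj (inducedGroup Λ Γ) '' (QuotientAddGroup.mk '' (proj Γ ⁻¹' U)) := by
      rw [← Set.image_preimage_eq U (proj_surjective (Γ := Γ)), Set.image_image, Set.image_image,
        Set.image_preimage_eq U (proj_surjective (Γ := Γ))]
      rfl
    rw [this]
    exact isOpenMap_proj _ (QuotientAddGroup.isOpenMap_coe _ (hU.preimage continuous_proj))
  have hbij : Function.Bijective f := by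
    constructor
    · rintro ⟨x⟩ ⟨y⟩ h
      exact (key x y).1 h
    · intro q
      obtain ⟨p, rfl⟩ := proj_surjective q
      obtain ⟨x, rfl⟩ := QuotientAddGroup.mk_surjective p
      exact ⟨proj Γ x, rfl⟩
  exact ⟨(Equiv.ofBijective f hbij).toHomeomorphOfContinuousOpen hf hopen, fun x => rfl⟩

/-- The projection to a torus is isometric on small balls. -/
theorem dist_mk_eq {r : ℝ} (hr : ∀ v ∈ Λ, v ≠ 0 → 2 * r ≤ ‖v‖) {x y : E n} (hxy : dist x y ≤ r) :
    dist (QuotientAddGroup.mk x : Torus Λ) (QuotientAddGroup.mk y) = dist x y := by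
  rw [dist_eq_norm, ← QuotientAddGroup.mk_sub, dist_eq_norm]
  refine le_antisymm QuotientAddGroup.norm_mk_le_norm (QuotientAddGroup.le_norm_iff.2 fun w hw => ?_)
  rw [QuotientAddGroup.eq] at hw
  by_cases h0 : -w + (x - y) = 0
  · rw [neg_add_eq_zero.1 h0]
  · have h1 := hr _ hw h0
    -- Any other representative `w` differs from `x - y` by a lattice vector of length at least
    -- `2r`, so its norm is at least `r`.
    have h2 : ‖-w + (x - y)‖ ≤ ‖w‖ + ‖x - y‖ := by
      simpa using norm_add_le (-w) (x - y)
    rw [dist_eq_norm] at hxy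
    linarith

/-- The local lifts are restrictions of the covering projection to balls of radius `r / 2`, whose
points are less than `r` apart. -/
theorem orbifoldIsometric_inducedGroup {Γ : Subgroup (E n ≃ᵢ E n)} (hΛ : ∀ v ∈ Λ, transl v ∈ Γ)
    (hΓ : ∀ g ∈ Γ, ∃ h : Torus Λ ≃ᵢ Torus Λ, Induces g h) {r : ℝ} (hr0 : 0 < r)
    (hr : ∀ v ∈ Λ, v ≠ 0 → 2 * r ≤ ‖v‖) : OrbifoldIsometric Γ (inducedGroup Λ Γ) := by
  obtain ⟨f, hf⟩ := exists_homeomorph_inducedGroup hΛ hΓ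
  refine ⟨f, fun x => ?_⟩
  have hdist : ∀ y ∈ Metric.ball x (r / 2), ∀ z ∈ Metric.ball x (r / 2),
      dist (QuotientAddGroup.mk y : Torus Λ) (QuotientAddGroup.mk z) = dist y z := by
    intro y hy z hz
    refine dist_mk_eq hr ?_
    rw [Metric.mem_ball] at hy hz
    linarith [dist_triangle_right y z x]
  have hinj : Set.InjOn (QuotientAddGroup.mk : E n → Torus Λ) (Metric.ball x (r / 2)) := by
    intro y hy z hz hyz
    rw [← dist_eq_zero, ← hdist y hy z hz, hyz, dist_self]
  refine ⟨OpenPartialHomeomorph.ofContinuousOpen (hinj.toPartialEquiv _ _)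
    (Continuous.continuousOn continuous_quot_mk) QuotientAddGroup.isOpenMap_coe Metric.isOpen_ball,
    Metric.mem_ball_self (by linarith), hdist, fun y _ => hf y⟩

end Torus

/-! ### Signed permutations and translations by quarter lattice vectors -/

/-- The isometry `g` is composed of a signed permutation of the coordinates and a translation by
a vector of `Λ / 4`. -/
def HasSignedForm (g : E 3 ≃ᵢ E 3) (d : Equiv.Perm (Fin 3) × (Fin 3 → ℤˣ) × (Fin 3 → ℤ)) : Prop :=
  ∀ x i, g x i = ((d.2.1 i : ℤ) : ℝ) * x (d.1 i) + d.2.2 i / 2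

theorem units_cast_mul_self (u : ℤˣ) : ((u : ℤ) : ℝ) * ((u : ℤ) : ℝ) = 1 := by
  rw [← Int.cast_mul, ← Units.val_mul, Int.units_mul_self]
  simp

/-- The group generated by the signed permutations of coordinates and the translations by vectors
of `Λ / 4`. -/
def signedGroup : Subgroup (E 3 ≃ᵢ E 3) where
  carrier := {g | ∃ d, HasSignedForm g d}
  one_mem' := ⟨(1, 1, 0), fun x i => by simp⟩
  mul_mem' := by
    rintro g h ⟨⟨σ, ε, m⟩, hg⟩ ⟨⟨τ, δ, k⟩, hh⟩
    refine ⟨(σ.trans τ, fun i => ε i * δ (σ i), fun i => ε i * k (σ i) + m i), fun x i => ?_⟩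
    rw [IsometryEquiv.mul_apply, hg, hh]
    simp only [Equiv.trans_apply, Units.val_mul]
    push_cast
    ring
  inv_mem' := by
    rintro g ⟨⟨σ, ε, m⟩, hg⟩
    refine ⟨(σ.symm, fun i => ε (σ.symm i), fun i => -(ε (σ.symm i) * m (σ.symm i))),
      fun x i => ?_⟩
    have h := hg (g⁻¹ x) (σ.symm i)
    simp only [IsometryEquiv.apply_inv_self, Equiv.apply_symm_apply] at h
    rw [h]
    have := units_cast_mul_self (ε (σ.symm i))
    push_cast
    linear_combination (-(g⁻¹ x) i) * this

theorem mapsCosets_of_mem_signedGroup {g : E 3 ≃ᵢ E 3} (hg : g ∈ signedGroup) :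
    MapsCosets Lam g := by
  obtain ⟨⟨σ, ε, m⟩, hg⟩ := hg
  intro x v hv i
  obtain ⟨k, hk⟩ := hv (σ i)
  refine ⟨ε i * k, ?_⟩
  rw [PiLp.sub_apply, hg, hg, PiLp.add_apply]
  simp only [hk]
  push_cast
  ring

theorem exists_induces_of_mem_signedGroup {g : E 3 ≃ᵢ E 3} (hg : g ∈ signedGroup) :
    ∃ h : Torus Lam ≃ᵢ Torus Lam, Induces g h :=
  (mapsCosets_of_mem_signedGroup hg).exists_induces
    (mapsCosets_of_mem_signedGroup (signedGroup.inv_mem hg))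

theorem ortho_mul_transl_apply {B : Matrix.orthogonalGroup (Fin 3) ℝ} {σ : Equiv.Perm (Fin 3)}
    (hB : B.1 = σ.permMatrix ℝ) (b x : E 3) (i : Fin 3) :
    (ortho B * transl b) x i = x (σ i) + b (σ i) := by
  rw [IsometryEquiv.mul_apply, ortho_apply, hB, Matrix.permMatrix_mulVec]
  rfl

theorem permSet_subset_signedGroup : permSet ⊆ signedGroup := by
  rintro g ⟨B, b, ⟨σ, hB⟩, hb, rfl⟩
  choose m hm using hb
  refine ⟨(σ, 1, fun i => m (σ i)), fun x i => ?_⟩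
  rw [ortho_mul_transl_apply hB]
  have := hm (σ i)
  simp at this ⊢
  linarith

theorem HasOffsets.le_signedGroup {Γ : Subgroup (E 3 ≃ᵢ E 3)} {c : Fin 4 → Fin 3 → ℤ}
    (h : HasOffsets Γ c) : Γ ≤ signedGroup := by
  intro g hg
  obtain ⟨j, m, hg⟩ := (h g).1 hg
  refine ⟨(1, fun i => if sgn j i = 1 then 1 else -1, fun i => 2 * (2 * m i + c j i)),
    fun x i => ?_⟩
  rw [hg]
  rcases sgn_cases j i with h | h <;> simp [h]

theorem bigGroup_le : bigGroup ≤ inducedGroup Lam signedGroup := by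
  refine (Subgroup.closure_le _).2 (Set.union_subset (Set.union_subset ?_ ?_) ?_)
  · exact inducedGroup_mono hasOffsets₁.le_signedGroup
  · exact inducedGroup_mono hasOffsets₂.le_signedGroup
  · rintro h ⟨g, hg, hgh⟩
    exact ⟨g, permSet_subset_signedGroup hg, hgh⟩

/-- Translational parts are half-integral and `Λ` consists of even vectors, so the induced map
depends on the numerators only modulo four. -/
theorem finite_inducedGroup_signedGroup :
    (inducedGroup Lam signedGroup : Set (Torus Lam ≃ᵢ Torus Lam)).Finite := by
  classical
  let P : Equiv.Perm (Fin 3) × (Fin 3 → ℤˣ) × (Fin 3 → Fin 4) → (Torus Lam ≃ᵢ Torus Lam) → Prop :=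
    fun d h => ∀ x : E 3, h (QuotientAddGroup.mk x) = QuotientAddGroup.mk
      (WithLp.toLp 2 fun i => ((d.2.1 i : ℤ) : ℝ) * x (d.1 i) + ((d.2.2 i : ℕ) : ℝ) / 2)
  -- The value 1 is a default for data that induce no isometry.
  refine (Set.finite_range fun d => if hd : ∃ h, P d h then hd.choose else 1).subset ?_
  rintro h ⟨g, ⟨⟨σ, ε, m⟩, hg⟩, hgh⟩
  have hm : ∀ i, 0 ≤ m i % 4 ∧ m i % 4 < 4 := fun i => by omega
  have hP : P (σ, ε, fun i => ⟨(m i % 4).toNat, by have := hm i; omega⟩) h := by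
    intro x
    rw [hgh, QuotientAddGroup.eq]
    intro i
    refine ⟨-(m i / 4), ?_⟩
    have h1 : (((m i % 4).toNat : ℕ) : ℝ) = (m i : ℝ) - 4 * ((m i / 4 : ℤ) : ℝ) := by
      have h2 : (((m i % 4).toNat : ℕ) : ℤ) = m i - 4 * (m i / 4) := by have := hm i; omega
      have h3 := congrArg (Int.cast : ℤ → ℝ) h2
      push_cast at h3
      exact h3
    rw [PiLp.add_apply, PiLp.neg_apply, hg]
    simp only [h1]
    push_cast
    ring
  refine ⟨_, (dif_pos ⟨h, hP⟩).trans ?_⟩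
  have hex : ∃ h, P (σ, ε, fun i => ⟨(m i % 4).toNat, by have := hm i; omega⟩) h := ⟨h, hP⟩
  ext p
  induction p using QuotientAddGroup.induction_on with
  | H x => rw [hex.choose_spec x, hP x]

theorem finite_bigGroup : Finite bigGroup :=
  (finite_inducedGroup_signedGroup.subset bigGroup_le).to_subtype

/-! ### The induced groups -/

theorem HasOffsets.transl_mem {Γ : Subgroup (E 3 ≃ᵢ E 3)} {c : Fin 4 → Fin 3 → ℤ}
    (h : HasOffsets Γ c) (h0 : c 0 = 0) {v : E 3} (hv : v ∈ Lam) : transl v ∈ Γ := by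
  choose m hm using hv
  refine (h _).2 ⟨0, m, fun x i => ?_⟩
  rw [transl_apply, PiLp.add_apply, hm, h0]
  fin_cases i <;> simp [sgn]

theorem inducedGroup_eq {Γ : Subgroup (E 3 ≃ᵢ E 3)} {b : Fin 4 → E 3}
    (hΓ : (Γ : Set (E 3 ≃ᵢ E 3)) = rhoSet b) :
    (inducedGroup Lam Γ : Set (Torus Lam ≃ᵢ Torus Lam)) = {h | ∃ j, Induces (rho b j) h} := by
  ext h
  constructor
  · rintro ⟨g, hg, hgh⟩
    rw [← SetLike.mem_coe, hΓ] at hg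
    obtain ⟨j, v, hv, rfl⟩ := hg
    refine ⟨j, fun x => ?_⟩
    -- The lattice translation in `g` disappears on the torus: evaluate at `x - v` instead of `x`.
    have : (QuotientAddGroup.mk x : Torus Lam) = QuotientAddGroup.mk (x + -v) := by
      rw [QuotientAddGroup.eq, neg_add_cancel_left]
      exact Lam.neg_mem hv
    rw [this, hgh, IsometryEquiv.mul_apply, transl_apply, neg_add_cancel_right]
  · rintro ⟨j, hj⟩
    refine ⟨rho b j, ?_, hj⟩
    rw [← SetLike.mem_coe, hΓ]
    exact ⟨j, 0, Lam.zero_mem, IsometryEquiv.ext fun x => by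
      rw [IsometryEquiv.mul_apply, transl_apply, add_zero]⟩

theorem rho_mem {Γ : Subgroup (E 3 ≃ᵢ E 3)} {b : Fin 4 → E 3}
    (hΓ : (Γ : Set (E 3 ≃ᵢ E 3)) = rhoSet b) (j : Fin 4) : rho b j ∈ Γ := by
  rw [← SetLike.mem_coe, hΓ]
  exact ⟨j, 0, Lam.zero_mem, IsometryEquiv.ext fun x => by
    rw [IsometryEquiv.mul_apply, transl_apply, add_zero]⟩

/-! ### Almost conjugacy -/

/-- The permutations of the coordinates in the isometries conjugating `ρ_j` to `ρ'_j`. -/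
def conjPerm : Fin 4 → Equiv.Perm (Fin 3) := ![1, Equiv.swap 1 2, 1, Equiv.swap 0 2]

/-- The translational parts of the isometries conjugating `ρ_j` to `ρ'_j`. -/
noncomputable def conjTrans : Fin 4 → E 3 := ![0, !₂[1 / 2, 0, 0], 0, !₂[0, 1 / 2, 0]]

theorem permMatrix_mem_orthogonalGroup (σ : Equiv.Perm (Fin 3)) :
    σ.permMatrix ℝ ∈ Matrix.orthogonalGroup (Fin 3) ℝ := by
  rw [Matrix.mem_orthogonalGroup_iff, Matrix.transpose_permMatrix, ← Matrix.permMatrix_mul]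
  simp

/-- The isometries conjugating `ρ_j` to `ρ'_j`. -/
noncomputable def conjIsom (j : Fin 4) : E 3 ≃ᵢ E 3 :=
  ortho ⟨(conjPerm j).permMatrix ℝ, permMatrix_mem_orthogonalGroup _⟩ * transl (conjTrans j)

theorem conjIsom_apply (j : Fin 4) (x : E 3) (i : Fin 3) :
    conjIsom j x i = x (conjPerm j i) + conjTrans j (conjPerm j i) :=
  ortho_mul_transl_apply rfl _ _ _

theorem conjIsom_mem (j : Fin 4) : conjIsom j ∈ permSet := by
  refine ⟨_, _, ⟨_, rfl⟩, fun i => ?_, rfl⟩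
  have : ∃ m : ℤ, conjTrans j i = m / 2 := by
    refine ⟨(![![0, 0, 0], ![1, 0, 0], ![0, 0, 0], ![0, 1, 0]] : Fin 4 → Fin 3 → ℤ) j i, ?_⟩
    fin_cases j <;> fin_cases i <;> simp [conjTrans]
  obtain ⟨m, hm⟩ := this
  refine ⟨m, ?_⟩
  rw [PiLp.smul_apply, hm, smul_eq_mul]
  ring

/-- For `j = 1`, ρ_j is a glide reflection in the plane where coordinate 0 is -1/2, with glide along
coordinate 1. The half step moves the mirror to 0 and the swap turns the glide vertical. The case `j
= 3` is the same with coordinates 0 and 1 exchanged. -/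
theorem conjIsom_mul_rho (j : Fin 4) :
    conjIsom j * rho trans₁ j = rho trans₂ j * conjIsom j := by
  ext x i
  rw [IsometryEquiv.mul_apply, IsometryEquiv.mul_apply, conjIsom_apply, rho_apply, rho_apply,
    conjIsom_apply, trans₁_apply, trans₂_apply]
  fin_cases j <;> fin_cases i <;>
    simp [conjPerm, conjTrans, sgn, off₁, off₂, Equiv.swap_apply_def] <;> ring

/-- At the point with all coordinates 1/4, different signs in a coordinate would give values
differing by a half-integer, never a lattice value. So the signs agree, and they determine the
index. -/
theorem rho_induced_injective {b : Fin 4 → E 3} {c : Fin 4 → Fin 3 → ℤ}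
    (hb : ∀ j i, b j i = c j i) {h : Torus Lam ≃ᵢ Torus Lam} {j k : Fin 4}
    (hj : Induces (rho b j) h) (hk : Induces (rho b k) h) : j = k := by
  have h1 := (hj (WithLp.toLp 2 fun _ => 1 / 4)).symm.trans (hk _)
  rw [QuotientAddGroup.eq] at h1
  have h2 : ∀ i, sgn j i = sgn k i := by
    intro i
    obtain ⟨m, hm⟩ := h1 i
    rw [PiLp.add_apply, PiLp.neg_apply, rho_apply, rho_apply, hb, hb] at hm
    have h3 : (-sgn j i * (1 + 4 * c j i) + sgn k i * (1 + 4 * c k i) : ℤ) = 8 * m := by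
      have h4 : ((-sgn j i * (1 + 4 * c j i) + sgn k i * (1 + 4 * c k i) : ℤ) : ℝ) =
          ((8 * m : ℤ) : ℝ) := by
        push_cast
        simp only at hm
        linear_combination 4 * hm
      exact_mod_cast h4
    rcases sgn_cases j i with e | e <;> rcases sgn_cases k i with e' | e' <;>
      rw [e, e'] at h3 ⊢ <;> omega
  clear h1 hj hk
  revert h2
  revert j k
  decide

/-- A conjugacy class meets both enumerations in the same set of indices. -/
theorem almostConjugate_of_range {G : Type*} [Group G] {H₁ H₂ : Subgroup G} {ι : Type*} [Finite ι]
    {r₁ r₂ : ι → G} (h₁ : Function.Injective r₁) (h₂ : Function.Injective r₂)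
    (e₁ : (H₁ : Set G) = Set.range r₁) (e₂ : (H₂ : Set G) = Set.range r₂)
    (h : ∀ i, IsConj (r₁ i) (r₂ i)) : AlmostConjugate H₁ H₂ := by
  refine ⟨?_, ?_, fun b => ?_⟩
  · exact (e₁ ▸ Set.finite_range r₁ : (H₁ : Set G).Finite).to_subtype
  · exact (e₂ ▸ Set.finite_range r₂ : (H₂ : Set G).Finite).to_subtype
  · rw [e₁, e₂, ← Set.image_preimage_eq_inter_range, ← Set.image_preimage_eq_inter_range,
      Set.ncard_image_of_injective _ h₁, Set.ncard_image_of_injective _ h₂]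
    congr 1
    ext i
    exact ⟨fun hi => IsConj.trans hi (h i), fun hi => IsConj.trans hi (h i).symm⟩

theorem inducedGroup₁_le : inducedGroup Lam Gam₁ ≤ bigGroup := fun _ hh =>
  Subgroup.subset_closure (Or.inl (Or.inl hh))

theorem inducedGroup₂_le : inducedGroup Lam Gam₂ ≤ bigGroup := fun _ hh =>
  Subgroup.subset_closure (Or.inl (Or.inr hh))

theorem almostConjugate_inducedGroups :
    AlmostConjugate ((inducedGroup Lam Gam₁).subgroupOf bigGroup)
      ((inducedGroup Lam Gam₂).subgroupOf bigGroup) := by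
  choose h₁ hh₁ using fun j => exists_induces_of_mem_signedGroup
    (hasOffsets₁.le_signedGroup (rho_mem coe_Gam₁ j))
  choose h₂ hh₂ using fun j => exists_induces_of_mem_signedGroup
    (hasOffsets₂.le_signedGroup (rho_mem coe_Gam₂ j))
  choose k hk using fun j => exists_induces_of_mem_signedGroup
    (permSet_subset_signedGroup (conjIsom_mem j))
  have m₁ : ∀ j, h₁ j ∈ inducedGroup Lam Gam₁ := fun j => ⟨_, rho_mem coe_Gam₁ j, hh₁ j⟩
  have m₂ : ∀ j, h₂ j ∈ inducedGroup Lam Gam₂ := fun j => ⟨_, rho_mem coe_Gam₂ j, hh₂ j⟩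
  have mk : ∀ j, k j ∈ bigGroup := fun j =>
    Subgroup.subset_closure (Or.inr ⟨_, conjIsom_mem j, hk j⟩)
  refine almostConjugate_of_range (r₁ := fun j => (⟨h₁ j, inducedGroup₁_le (m₁ j)⟩ : bigGroup))
    (r₂ := fun j => (⟨h₂ j, inducedGroup₂_le (m₂ j)⟩ : bigGroup)) ?_ ?_ ?_ ?_ ?_
  · intro i j hij
    have : h₁ i = h₁ j := congrArg Subtype.val hij
    exact rho_induced_injective trans₁_apply (hh₁ i) (this ▸ hh₁ j)
  · intro i j hij
    have : h₂ i = h₂ j := congrArg Subtype.val hij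
    exact rho_induced_injective trans₂_apply (hh₂ i) (this ▸ hh₂ j)
  · ext h
    rw [SetLike.mem_coe, Subgroup.mem_subgroupOf, ← SetLike.mem_coe, inducedGroup_eq coe_Gam₁]
    constructor
    · rintro ⟨j, hj⟩
      exact ⟨j, Subtype.ext ((hh₁ j).unique hj)⟩
    · rintro ⟨j, rfl⟩
      exact ⟨j, hh₁ j⟩
  · ext h
    rw [SetLike.mem_coe, Subgroup.mem_subgroupOf, ← SetLike.mem_coe, inducedGroup_eq coe_Gam₂]
    constructor
    · rintro ⟨j, hj⟩
      exact ⟨j, Subtype.ext ((hh₂ j).unique hj)⟩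
    · rintro ⟨j, rfl⟩
      exact ⟨j, hh₂ j⟩
  · intro j
    refine isConj_iff.2 ⟨⟨k j, mk j⟩, mul_inv_eq_iff_eq_mul.2 (Subtype.ext ?_)⟩
    have e := (hk j).mul (hh₁ j)
    rw [conjIsom_mul_rho] at e
    exact e.unique ((hh₂ j).mul (hk j))

theorem two_le_norm_of_mem_Lam {v : E 3} (hv : v ∈ Lam) (h0 : v ≠ 0) : 2 * 1 ≤ ‖v‖ := by
  have : ∃ i, v i ≠ 0 := by
    by_contra! h
    exact h0 (PiLp.ext h)
  obtain ⟨i, hi⟩ := this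
  obtain ⟨m, hm⟩ := hv i
  have hm0 : m ≠ 0 := by
    rintro rfl
    simp [hm] at hi
  refine le_trans ?_ (PiLp.norm_apply_le v i)
  rw [hm, norm_mul, Real.norm_ofNat, Real.norm_eq_abs]
  have : (1 : ℝ) ≤ |(m : ℝ)| := by exact_mod_cast Int.one_le_abs hm0
  linarith

theorem HasOffsets.orbifoldIsometric {Γ : Subgroup (E 3 ≃ᵢ E 3)} {c : Fin 4 → Fin 3 → ℤ}
    (h : HasOffsets Γ c) (h0 : c 0 = 0) : OrbifoldIsometric Γ (inducedGroup Lam Γ) :=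
  orbifoldIsometric_inducedGroup (fun _ hv => h.transl_mem h0 hv)
    (fun _ hg => exists_induces_of_mem_signedGroup (h.le_signedGroup hg)) one_pos
    fun _ => two_le_norm_of_mem_Lam

/-! ### Proper discontinuity -/

theorem exists_pos_forall_add_int (a : ℝ) : ∃ ε > 0, ∀ m : ℤ, |a + m| < ε → a + m = 0 := by
  rcases (Int.fract_nonneg a).eq_or_lt with h | h
  · refine ⟨1, one_pos, fun m hm => ?_⟩
    have ha : a = ⌊a⌋ := by linarith [Int.floor_add_fract a]
    rw [ha] at hm ⊢
    have h1 : |⌊a⌋ + m| < 1 := by exact_mod_cast hm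
    have h2 : ⌊a⌋ + m = 0 := Int.abs_lt_one_iff.1 h1
    exact_mod_cast h2
  · refine ⟨min (Int.fract a) (1 - Int.fract a),
      lt_min h (by linarith [Int.fract_lt_one a]), fun m hm => ?_⟩
    obtain ⟨h1, h2⟩ := lt_min_iff.1 hm
    rw [abs_lt] at h1 h2
    have h3 := Int.floor_add_fract a
    have h4 : (-1 : ℝ) < (⌊a⌋ + m : ℤ) := by push_cast; linarith
    have h5 : ((⌊a⌋ + m : ℤ) : ℝ) < 0 := by push_cast; linarith
    norm_cast at h4 h5
    omega

/-- In each coordinate the orbit of `x` lies in finitely many translates of ℤ, one for each `j`, so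
a common positive gap separates the values different from that of `y`. -/
theorem HasOffsets.exists_pos {Γ : Subgroup (E 3 ≃ᵢ E 3)} {c : Fin 4 → Fin 3 → ℤ}
    (h : HasOffsets Γ c) (x y : E 3) : ∃ ε > 0, ∀ g ∈ Γ, dist (g x) y < ε → g x = y := by
  have key : ∀ᶠ ε in nhdsWithin (0 : ℝ) (Set.Ioi 0), ∀ (j : Fin 4) (i : Fin 3) (m : ℤ),
      |sgn j i * x i - y i + m| < ε → sgn j i * x i - y i + m = 0 := by
    rw [Filter.eventually_all]
    intro j
    rw [Filter.eventually_all]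
    intro i
    obtain ⟨ε, hε, hm⟩ := exists_pos_forall_add_int (sgn j i * x i - y i)
    filter_upwards [Ioo_mem_nhdsGT hε] with δ hδ m hlt
    exact hm m (hlt.trans hδ.2)
  obtain ⟨ε, hε, hpos⟩ := (key.and self_mem_nhdsWithin).exists
  refine ⟨ε, hpos, fun g hg hd => PiLp.ext fun i => ?_⟩
  obtain ⟨j, m, hg⟩ := (h g).1 hg
  have h1 := hε j i (2 * m i + c j i)
  have h2 : sgn j i * x i - y i + ((2 * m i + c j i : ℤ) : ℝ) = g x i - y i := by
    rw [hg]
    push_cast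
    ring
  rw [h2] at h1
  refine sub_eq_zero.1 (h1 (lt_of_le_of_lt ?_ hd))
  rw [dist_eq_norm]
  exact PiLp.norm_apply_le (g x - y) i

section OrbitSpace

variable {M N : Type*} [PseudoMetricSpace M] [PseudoMetricSpace N] {Γ : Subgroup (M ≃ᵢ M)}
  {Γ' : Subgroup (N ≃ᵢ N)}

theorem t2Space_orbitSpace (h : ∀ x y : M, ∃ ε > 0, ∀ g ∈ Γ, dist (g x) y < ε → g x = y) :
    T2Space (OrbitSpace Γ) := by
  refine ⟨fun p q hpq => ?_⟩
  obtain ⟨x, rfl⟩ := proj_surjective p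
  obtain ⟨y, rfl⟩ := proj_surjective q
  obtain ⟨ε, hε, hxy⟩ := h x y
  refine ⟨proj Γ '' Metric.ball x (ε / 2), proj Γ '' Metric.ball y (ε / 2),
    isOpenMap_proj _ Metric.isOpen_ball, isOpenMap_proj _ Metric.isOpen_ball,
    ⟨x, Metric.mem_ball_self (half_pos hε), rfl⟩, ⟨y, Metric.mem_ball_self (half_pos hε), rfl⟩, ?_⟩
  rw [Set.disjoint_left]
  rintro _ ⟨a, ha, rfl⟩ ⟨b, hb, hab⟩
  obtain ⟨g, hg, rfl⟩ := proj_eq_proj_iff.1 hab.symm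
  refine hpq (proj_eq_proj_iff.2 ⟨g, hg, hxy g hg ?_⟩)
  rw [Metric.mem_ball] at ha hb
  have h1 := dist_triangle (g x) (g a) y
  rw [g.dist_eq, dist_comm x a] at h1
  linarith

/-- The projection to the orbit space is injective near `x`. -/
def LocallyInjectiveAt (Γ : Subgroup (M ≃ᵢ M)) (x : M) : Prop :=
  ∃ U ∈ nhds x, Set.InjOn (proj Γ) U

theorem locallyInjectiveAt_of_isotropy_eq_bot
    (h : ∀ x y : M, ∃ ε > 0, ∀ g ∈ Γ, dist (g x) y < ε → g x = y) {x : M}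
    (hx : isotropy Γ x = ⊥) : LocallyInjectiveAt Γ x := by
  obtain ⟨ε, hε, hxx⟩ := h x x
  refine ⟨Metric.ball x (ε / 2), Metric.ball_mem_nhds _ (half_pos hε), fun a ha b hb hab => ?_⟩
  obtain ⟨g, hg, rfl⟩ := proj_eq_proj_iff.1 hab
  rw [Metric.mem_ball] at ha hb
  have h1 := dist_triangle (g x) (g a) x
  rw [g.dist_eq, dist_comm x a] at h1
  have h2 : (⟨g, hg⟩ : Γ) ∈ isotropy Γ x := hxx g hg (by linarith)
  rw [hx, Subgroup.mem_bot] at h2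
  rw [show g = 1 from congrArg Subtype.val h2]
  rfl

/-- Local lifts transport local injectivity of the projection, so singular points can be recognized
without comparing isotropy groups. -/
theorem locallyInjectiveAt_iff {f : OrbitSpace Γ ≃ₜ OrbitSpace Γ'} {x : M}
    {φ : OpenPartialHomeomorph M N} (hx : x ∈ φ.source)
    (hφ : ∀ y ∈ φ.source, f (proj Γ y) = proj Γ' (φ y)) :
    LocallyInjectiveAt Γ x ↔ LocallyInjectiveAt Γ' (φ x) := by
  constructor
  · rintro ⟨U, hU, hinj⟩
    refine ⟨φ '' (φ.source ∩ U), φ.image_mem_nhds hx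
      (Filter.inter_mem (φ.open_source.mem_nhds hx) hU), ?_⟩
    rintro _ ⟨a, ⟨ha, haU⟩, rfl⟩ _ ⟨b, ⟨hb, hbU⟩, rfl⟩ hab
    rw [← hφ a ha, ← hφ b hb] at hab
    rw [hinj haU hbU (f.injective hab)]
  · rintro ⟨V, hV, hinj⟩
    refine ⟨φ.source ∩ φ ⁻¹' V, Filter.inter_mem (φ.open_source.mem_nhds hx)
      ((φ.continuousAt hx).preimage_mem_nhds hV), ?_⟩
    rintro a ⟨ha, haV⟩ b ⟨hb, hbV⟩ hab
    refine φ.injOn ha hb (hinj haV hbV ?_)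
    rw [← hφ a ha, ← hφ b hb, hab]

end OrbitSpace

/-! ### The singular sets -/

theorem HasOffsets.apply_mem_verticalLines {Γ : Subgroup (E 3 ≃ᵢ E 3)} {c : Fin 4 → Fin 3 → ℤ}
    (h : HasOffsets Γ c) {g : E 3 ≃ᵢ E 3} (hg : g ∈ Γ) {x : E 3} (hx : x ∈ verticalLines) :
    g x ∈ verticalLines := by
  obtain ⟨j, m, hg⟩ := (h g).1 hg
  obtain ⟨⟨a, ha⟩, ⟨b, hb⟩⟩ := hx
  refine ⟨⟨sgn j 0 * a + (2 * m 0 + c j 0), ?_⟩, ⟨sgn j 1 * b + (2 * m 1 + c j 1), ?_⟩⟩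
  · rw [hg, ha]
    push_cast
    ring
  · rw [hg, hb]
    push_cast
    ring

theorem exists_hasOffsets {Γ : Subgroup (E 3 ≃ᵢ E 3)} (hΓ : Γ = Gam₁ ∨ Γ = Gam₂) :
    ∃ c, HasOffsets Γ c := by
  rcases hΓ with rfl | rfl
  · exact ⟨_, hasOffsets₁⟩
  · exact ⟨_, hasOffsets₂⟩

theorem proj_mem_singularSet_iff {Γ : Subgroup (E 3 ≃ᵢ E 3)} (hΓ : Γ = Gam₁ ∨ Γ = Gam₂)
    (x : E 3) : proj Γ x ∈ singularSet Γ ↔ x ∈ verticalLines := by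
  constructor
  · rintro ⟨y, hy, hiso⟩
    obtain ⟨g, hg, rfl⟩ := proj_eq_proj_iff.1 hy
    obtain ⟨c, hc⟩ := exists_hasOffsets hΓ
    exact hc.apply_mem_verticalLines hg ((isotropy_ne_bot_iff hΓ y).1 hiso)
  · exact fun hx => ⟨x, rfl, (isotropy_ne_bot_iff hΓ x).2 hx⟩

/-- The half-turn about a vertical line identifies opposite points arbitrarily close to the axis;
elsewhere the isotropy is trivial. -/
theorem locallyInjectiveAt_iff_notMem {Γ : Subgroup (E 3 ≃ᵢ E 3)} (hΓ : Γ = Gam₁ ∨ Γ = Gam₂)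
    (x : E 3) : LocallyInjectiveAt Γ x ↔ x ∉ verticalLines := by
  constructor
  · rintro ⟨U, hU, hinj⟩ hx
    obtain ⟨g, hg, hgx⟩ := exists_rotation hΓ hx
    obtain ⟨δ, hδ, hball⟩ := Metric.mem_nhds_iff.1 hU
    have hmem : ∀ s : ℝ, |s| < δ → x + EuclideanSpace.single 0 s ∈ U := fun s hs => hball (by
      rw [Metric.mem_ball, dist_eq_norm, add_sub_cancel_left, PiLp.norm_single]
      exact hs)
    have habs : |δ / 2| < δ := by rw [abs_of_pos (half_pos hδ)]; linarith
    have h1 : g (x + EuclideanSpace.single 0 (δ / 2)) = x + EuclideanSpace.single 0 (-(δ / 2)) := by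
      ext i
      rw [hgx]
      fin_cases i <;> simp [sgn]
      ring
    have h2 := hinj (hmem _ habs) (hmem (-(δ / 2)) (by rwa [abs_neg]))
      (proj_eq_proj_iff.2 ⟨g, hg, h1⟩)
    have h3 := congrArg (fun y : E 3 => y 0) h2
    simp at h3
    linarith
  · intro hx
    obtain ⟨c, hc⟩ := exists_hasOffsets hΓ
    exact locallyInjectiveAt_of_isotropy_eq_bot hc.exists_pos
      (not_not.1 fun h => hx ((isotropy_ne_bot_iff hΓ x).1 h))

theorem nonempty_homeomorph_singularSet {Γ Γ' : Subgroup (E 3 ≃ᵢ E 3)}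
    (hΓ : Γ = Gam₁ ∨ Γ = Gam₂) (hΓ' : Γ' = Gam₁ ∨ Γ' = Gam₂) (h : OrbifoldIsometric Γ Γ') :
    Nonempty (singularSet Γ ≃ₜ singularSet Γ') := by
  obtain ⟨f, hf⟩ := h
  refine ⟨f.subtype fun p => ?_⟩
  obtain ⟨x, rfl⟩ := proj_surjective p
  obtain ⟨φ, hx, -, hφ⟩ := hf x
  rw [hφ x hx, proj_mem_singularSet_iff hΓ, proj_mem_singularSet_iff hΓ', ← not_iff_not,
    ← locallyInjectiveAt_iff_notMem hΓ, ← locallyInjectiveAt_iff_notMem hΓ']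
  exact locallyInjectiveAt_iff hx hφ

/-- The index is continuous into a discrete space and its fibres are connected. -/
theorem card_connectedComponents {n : ℕ} {X S : Type*} [TopologicalSpace X] [ConnectedSpace X]
    [TopologicalSpace S] (e : (Fin n × X) ≃ₜ S) : Nat.card (ConnectedComponents S) = n := by
  have hc : Continuous fun s => (e.symm s).1 := continuous_fst.comp e.symm.continuous
  have hbij : Function.Bijective hc.connectedComponentsLift := by
    constructor
    · intro a b hab
      obtain ⟨s, rfl⟩ := ConnectedComponents.surjective_coe a
      obtain ⟨t, rfl⟩ := ConnectedComponents.surjective_coe b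
      rw [hc.connectedComponentsLift_apply_coe, hc.connectedComponentsLift_apply_coe] at hab
      rw [ConnectedComponents.coe_eq_coe']
      have hpre : IsPreconnected (e '' ({(e.symm t).1} ×ˢ Set.univ)) :=
        (isPreconnected_singleton.prod isPreconnected_univ).image _ e.continuous.continuousOn
      refine hpre.subset_connectedComponent ⟨e.symm t, ⟨rfl, trivial⟩, e.apply_symm_apply t⟩
        ⟨e.symm s, ⟨hab, trivial⟩, e.apply_symm_apply s⟩
    · intro i
      obtain ⟨x⟩ : Nonempty X := inferInstance
      refine ⟨ConnectedComponents.mk (e (i, x)), ?_⟩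
      rw [hc.connectedComponentsLift_apply_coe, e.symm_apply_apply]
  rw [Nat.card_eq_of_bijective _ hbij, Nat.card_eq_fintype_card, Fintype.card_fin]

/-! ### Circles in the singular sets -/

/-- The point at height `t` on the vertical line through `(a, b)`. -/
noncomputable def linePoint (a : ℤ × ℤ) (t : ℝ) : E 3 := !₂[(a.1 : ℝ), (a.2 : ℝ), t]

theorem dist_linePoint (a : ℤ × ℤ) (s t : ℝ) : dist (linePoint a s) (linePoint a t) = |s - t| := by
  rw [EuclideanSpace.dist_eq]
  simp [linePoint, Fin.sum_univ_three, Real.sqrt_sq_eq_abs, Real.dist_eq]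

/-- By `hshift` the height modulo `ℓ` is invariant, which bounds the orbit distance from below by
the distance on the circle; `hper` shows that this bound is attained. Each circle therefore embeds
with its whole metric. -/
theorem isDisjointUnionOfCircles_of_lines {Γ : Subgroup (E 3 ≃ᵢ E 3)}
    (hΓ : Γ = Gam₁ ∨ Γ = Gam₂) {n : ℕ} {ℓ : ℝ} (hℓ : 0 < ℓ) (a : Fin n → ℤ × ℤ)
    (hshift : ∀ g ∈ Γ, ∀ x, ∃ k : ℤ, g x 2 = x 2 + k * ℓ)
    (hper : ∀ i t, proj Γ (linePoint (a i) (t + ℓ)) = proj Γ (linePoint (a i) t))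
    (hinj : ∀ i j s t, proj Γ (linePoint (a i) s) = proj Γ (linePoint (a j) t) → i = j)
    (hsurj : ∀ x ∈ verticalLines, ∃ i t, proj Γ x = proj Γ (linePoint (a i) t)) :
    IsDisjointUnionOfCircles Γ (singularSet Γ) n ℓ := by
  obtain ⟨c, hc⟩ := exists_hasOffsets hΓ
  have : T2Space (OrbitSpace Γ) := t2Space_orbitSpace hc.exists_pos
  have : Fact (0 < ℓ) := ⟨hℓ⟩
  have hp : ∀ i, Function.Periodic (fun t => proj Γ (linePoint (a i) t)) ℓ := hper
  have hmem : ∀ i (s : AddCircle ℓ), (hp i).lift s ∈ singularSet Γ := by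
    intro i s
    induction s using QuotientAddGroup.induction_on with
    | H s =>
      rw [Function.Periodic.lift_coe, proj_mem_singularSet_iff hΓ]
      exact ⟨⟨(a i).1, rfl⟩, ⟨(a i).2, rfl⟩⟩
  have hdist : ∀ i (s t : AddCircle ℓ), orbitDist Γ ((hp i).lift s) ((hp i).lift t) = dist s t := by
    intro i s t
    induction s using QuotientAddGroup.induction_on with
    | H s =>
    induction t using QuotientAddGroup.induction_on with
    | H t =>
    rw [Function.Periodic.lift_coe, Function.Periodic.lift_coe, dist_eq_norm,
      ← QuotientAddGroup.mk_sub]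
    refine IsLeast.csInf_eq ⟨?_, ?_⟩
    -- Rounding selects the lift of `t` closest to `s`, where the circle distance is attained.
    · refine ⟨linePoint (a i) s, linePoint (a i) (t + (round (ℓ⁻¹ * (s - t)) : ℤ) * ℓ), rfl,
        (hp i).int_mul _ t, ?_⟩
      rw [dist_linePoint, AddCircle.norm_eq, sub_sub]
    · rintro _ ⟨x, y, hx, hy, rfl⟩
      obtain ⟨g, hg, rfl⟩ := proj_eq_proj_iff.1 hx.symm
      obtain ⟨h, hh, rfl⟩ := proj_eq_proj_iff.1 hy.symm
      obtain ⟨k, hk⟩ := hshift g hg (linePoint (a i) s)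
      obtain ⟨l, hl⟩ := hshift h hh (linePoint (a i) t)
      rw [dist_eq_norm]
      refine le_trans ?_ (PiLp.norm_apply_le _ (2 : Fin 3))
      rw [PiLp.sub_apply, hk, hl]
      have : ((s - t : ℝ) : AddCircle ℓ) = ((s + k * ℓ - (t + l * ℓ) : ℝ) : AddCircle ℓ) := by
        rw [QuotientAddGroup.eq, AddSubgroup.mem_zmultiples_iff]
        refine ⟨k - l, ?_⟩
        rw [zsmul_eq_mul]
        push_cast
        ring
      rw [this]
      exact QuotientAddGroup.norm_mk_le_norm
  let F : Fin n × AddCircle ℓ → singularSet Γ := fun q => ⟨(hp q.1).lift q.2, hmem q.1 q.2⟩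
  have hF : Continuous F := by
    refine Continuous.subtype_mk (continuous_prod_of_discrete_left.2 fun i => ?_) _
    refine continuous_coinduced_dom.2 (continuous_proj.comp (?_ : Continuous (linePoint (a i))))
    unfold linePoint
    fun_prop
  have hbij : Function.Bijective F := by
    constructor
    · rintro ⟨i, s⟩ ⟨j, t⟩ hst
      have hst' : (hp i).lift s = (hp j).lift t := congrArg Subtype.val hst
      have hij : i = j := by
        induction s using QuotientAddGroup.induction_on with
        | H s =>
        induction t using QuotientAddGroup.induction_on with
        | H t => exact hinj i j s t hst'
      subst hij
      have h := hdist i s t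
      rw [← hst', hdist, dist_self] at h
      rw [dist_eq_zero.1 h.symm]
    · rintro ⟨p, hpS⟩
      obtain ⟨x, rfl⟩ := proj_surjective p
      obtain ⟨i, t, ht⟩ := hsurj x ((proj_mem_singularSet_iff hΓ x).1 hpS)
      exact ⟨(i, t), Subtype.ext ht.symm⟩
  exact ⟨Continuous.homeoOfEquivCompactToT2 (f := Equiv.ofBijective F hbij) hF, fun i _ =>
    ⟨Set.univ, Filter.univ_mem, fun t _ t' _ => hdist i t t'⟩⟩

/-- The elements with `j = 1, 3` change the parity of both horizontal coordinates, so the parity of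
their sum is the invariant; heights move only by even integers. -/
theorem isDisjointUnionOfCircles₁ : IsDisjointUnionOfCircles Gam₁ (singularSet Gam₁) 2 2 := by
  refine isDisjointUnionOfCircles_of_lines (Or.inl rfl) two_pos ![(0, 0), (0, 1)] ?_ ?_ ?_ ?_
  · intro g hg x
    obtain ⟨j, m, h⟩ := (hasOffsets₁ g).1 hg
    refine ⟨m 2, ?_⟩
    rw [h]
    fin_cases j <;> simp [sgn, off₁] <;> ring
  · intro i t
    obtain ⟨g, hg, h⟩ := hasOffsets₁.exists_mem 0 ![0, 0, 1]
    refine (proj_eq_proj_iff.2 ⟨g, hg, PiLp.ext fun k => ?_⟩).symm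
    rw [h]
    fin_cases k <;> simp [sgn, off₁, linePoint]
  · intro i i' s t hst
    obtain ⟨g, hg, hgs⟩ := proj_eq_proj_iff.1 hst
    obtain ⟨j, m, h⟩ := (hasOffsets₁ g).1 hg
    have h0 := h (linePoint (![(0, 0), (0, 1)] i) s) 0
    have h1 := h (linePoint (![(0, 0), (0, 1)] i) s) 1
    rw [hgs] at h0 h1
    simp only [linePoint] at h0 h1
    dsimp at h0 h1
    norm_cast at h0 h1
    fin_cases i <;> fin_cases i' <;> first | rfl | skip
    all_goals
      exfalso
      fin_cases j <;> simp [sgn, off₁] at h0 h1 <;> omega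
  · rintro x ⟨⟨p, hp⟩, ⟨q, hq⟩⟩
    rcases Int.even_or_odd' p with ⟨k, hk | hk⟩ <;> rcases Int.even_or_odd' q with ⟨l, hl | hl⟩
    · obtain ⟨g, hg, h⟩ := hasOffsets₁.exists_mem 0 ![-k, -l, 0]
      refine ⟨0, x 2, proj_eq_proj_iff.2 ⟨g, hg, PiLp.ext fun i => ?_⟩⟩
      rw [h]
      fin_cases i <;> simp [sgn, off₁, linePoint, hp, hq, hk, hl]
    · obtain ⟨g, hg, h⟩ := hasOffsets₁.exists_mem 0 ![-k, -l, 0]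
      refine ⟨1, x 2, proj_eq_proj_iff.2 ⟨g, hg, PiLp.ext fun i => ?_⟩⟩
      rw [h]
      fin_cases i <;> simp [sgn, off₁, linePoint, hp, hq, hk, hl]
    · obtain ⟨g, hg, h⟩ := hasOffsets₁.exists_mem 1 ![k, -l, 0]
      refine ⟨1, x 2, proj_eq_proj_iff.2 ⟨g, hg, PiLp.ext fun i => ?_⟩⟩
      rw [h]
      fin_cases i <;> simp [sgn, off₁, linePoint, hp, hq, hk, hl]
    · obtain ⟨g, hg, h⟩ := hasOffsets₁.exists_mem 1 ![k, -l - 1, 0]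
      refine ⟨0, x 2, proj_eq_proj_iff.2 ⟨g, hg, PiLp.ext fun i => ?_⟩⟩
      rw [h]
      fin_cases i <;> simp [sgn, off₁, linePoint, hp, hq, hk, hl]
      ring

/-- Horizontal offsets are even, so both parities are invariant. Reflecting across a plane through
the line combines with the vertical glide to give the period one. -/
theorem isDisjointUnionOfCircles₂ : IsDisjointUnionOfCircles Gam₂ (singularSet Gam₂) 4 1 := by
  refine isDisjointUnionOfCircles_of_lines (Or.inr rfl) one_pos
    ![(0, 0), (0, 1), (1, 0), (1, 1)] ?_ ?_ ?_ ?_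
  · intro g hg x
    obtain ⟨j, m, h⟩ := (hasOffsets₂ g).1 hg
    refine ⟨2 * m 2 + off₂ j 2, ?_⟩
    rw [h]
    fin_cases j <;> simp [sgn, off₂]
  · intro i t
    obtain ⟨g, hg, h⟩ := hasOffsets₂.exists_mem 1
      ![(![(0, 0), (0, 1), (1, 0), (1, 1)] i : ℤ × ℤ).1, 0, 0]
    refine (proj_eq_proj_iff.2 ⟨g, hg, PiLp.ext fun k => ?_⟩).symm
    rw [h]
    fin_cases k <;> simp [sgn, off₂, linePoint]
    ring
  · intro i i' s t hst
    obtain ⟨g, hg, hgs⟩ := proj_eq_proj_iff.1 hst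
    obtain ⟨j, m, h⟩ := (hasOffsets₂ g).1 hg
    have h0 := h (linePoint (![(0, 0), (0, 1), (1, 0), (1, 1)] i) s) 0
    have h1 := h (linePoint (![(0, 0), (0, 1), (1, 0), (1, 1)] i) s) 1
    rw [hgs] at h0 h1
    simp only [linePoint] at h0 h1
    dsimp at h0 h1
    norm_cast at h0 h1
    fin_cases i <;> fin_cases i' <;> first | rfl | skip
    all_goals
      exfalso
      fin_cases j <;> simp [sgn, off₂] at h0 h1 <;> omega
  · rintro x ⟨⟨p, hp⟩, ⟨q, hq⟩⟩
    rcases Int.even_or_odd' p with ⟨k, hk⟩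
    rcases Int.even_or_odd' q with ⟨l, hl⟩
    obtain ⟨g, hg, h⟩ := hasOffsets₂.exists_mem 0 ![-k, -l, 0]
    have key : ∀ i : Fin 4, p - 2 * k = (![(0, 0), (0, 1), (1, 0), (1, 1)] i : ℤ × ℤ).1 →
        q - 2 * l = (![(0, 0), (0, 1), (1, 0), (1, 1)] i : ℤ × ℤ).2 →
        ∃ i t, proj Gam₂ x = proj Gam₂ (linePoint
          ((![(0, 0), (0, 1), (1, 0), (1, 1)] : Fin 4 → ℤ × ℤ) i) t) := by
      intro i h1 h2
      refine ⟨i, x 2, proj_eq_proj_iff.2 ⟨g, hg, PiLp.ext fun i => ?_⟩⟩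
      rw [h]
      unfold linePoint
      rw [← h1, ← h2]
      fin_cases i <;> simp [sgn, off₂, hp, hq] <;> ring
    rcases hk with hk | hk <;> rcases hl with hl | hl
    · exact key 0 (by simp [hk]) (by simp [hl])
    · exact key 1 (by simp [hk]) (by simp [hl])
    · exact key 2 (by simp [hk]) (by simp [hl])
    · exact key 3 (by simp [hk]) (by simp [hl])

theorem card_components₁ : Nat.card (ConnectedComponents (singularSet Gam₁)) = 2 := by
  obtain ⟨e, -⟩ := isDisjointUnionOfCircles₁
  exact card_connectedComponents e

theorem card_components₂ : Nat.card (ConnectedComponents (singularSet Gam₂)) = 4 := by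
  obtain ⟨e, -⟩ := isDisjointUnionOfCircles₂
  exact card_connectedComponents e

theorem not_orbifoldIsometric : ¬ OrbifoldIsometric Gam₁ Gam₂ := by
  intro h
  obtain ⟨f⟩ := nonempty_homeomorph_singularSet (Or.inl rfl) (Or.inr rfl) h
  obtain ⟨e, -⟩ := isDisjointUnionOfCircles₁
  have h2 := card_connectedComponents (e.trans f)
  rw [card_components₂] at h2
  omega

/-! ### Fourier coefficients of eigenfunctions -/

section Fourier

open MeasureTheory

theorem integral_divergence_eq_zero_of_periodic {F : Fin 3 → (Fin 3 → ℝ) → ℂ}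
    (hF : ∀ i, ContDiff ℝ 1 (F i)) (hper : ∀ i x, F i (x + Pi.single i 1) = F i x) :
    ∫ x in Set.Icc (0 : Fin 3 → ℝ) 1, ∑ i, fderiv ℝ (F i) x (Pi.single i 1) = 0 := by
  rw [integral_divergence_of_hasFDerivAt_off_countable' (n := 2) 0 1 zero_le_one F
    (fun i => fderiv ℝ (F i)) ∅ Set.countable_empty (fun i => (hF i).continuous.continuousOn)
    (fun x _ i => ((hF i).differentiable one_ne_zero x).hasFDerivAt)]
  · refine Finset.sum_eq_zero fun i _ => sub_eq_zero.2 ?_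
    congr 1
    funext y
    -- The front face is the back face moved by a unit vector, so opposite fluxes cancel.
    rw [← hper i (i.insertNth ((0 : Fin 3 → ℝ) i) y)]
    congr 1
    ext k
    rcases Fin.eq_self_or_eq_succAbove i k with rfl | ⟨l, rfl⟩ <;> simp
  · refine ContinuousOn.integrableOn_compact isCompact_Icc (Continuous.continuousOn ?_)
    exact continuous_finsetSum _ fun i _ =>
      ((hF i).continuous_fderiv one_ne_zero).clm_apply continuous_const

/-- Green's identity on the unit torus. -/
theorem integral_green_eq_zero {g e : (Fin 3 → ℝ) → ℂ} {g' e' : Fin 3 → (Fin 3 → ℝ) → ℂ}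
    {g'' e'' : Fin 3 → (Fin 3 → ℝ) → ℂ} (hg : ContDiff ℝ 1 g) (he : ContDiff ℝ 1 e)
    (hg' : ∀ i, ContDiff ℝ 1 (g' i)) (he' : ∀ i, ContDiff ℝ 1 (e' i))
    (dg : ∀ i x, fderiv ℝ g x (Pi.single i 1) = g' i x)
    (de : ∀ i x, fderiv ℝ e x (Pi.single i 1) = e' i x)
    (dg' : ∀ i x, fderiv ℝ (g' i) x (Pi.single i 1) = g'' i x)
    (de' : ∀ i x, fderiv ℝ (e' i) x (Pi.single i 1) = e'' i x)
    (pg : ∀ i x, g (x + Pi.single i 1) = g x) (pe : ∀ i x, e (x + Pi.single i 1) = e x) :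
    ∫ x in Set.Icc (0 : Fin 3 → ℝ) 1, (e x * ∑ i, g'' i x - g x * ∑ i, e'' i x) = 0 := by
  have pg' : ∀ i x, g' i (x + Pi.single i 1) = g' i x := fun i x => by
    rw [← dg, ← dg, ← fderiv_comp_add_right]
    simp only [pg]
  have pe' : ∀ i x, e' i (x + Pi.single i 1) = e' i x := fun i x => by
    rw [← de, ← de, ← fderiv_comp_add_right]
    simp only [pe]
  -- The divergence theorem is applied to the field e∇g - g∇e.
  rw [← integral_divergence_eq_zero_of_periodic
    (F := fun i x => e x * g' i x - g x * e' i x)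
    (fun i => (he.mul (hg' i)).sub (hg.mul (he' i)))
    (fun i x => by rw [pg, pe, pg', pe'])]
  congr 1
  funext x
  rw [Finset.mul_sum, Finset.mul_sum, ← Finset.sum_sub_distrib]
  refine Finset.sum_congr rfl fun i _ => ?_
  have d : ∀ {k : (Fin 3 → ℝ) → ℂ}, ContDiff ℝ 1 k → DifferentiableAt ℝ k x := fun hk =>
    hk.differentiable one_ne_zero x
  have hD : fderiv ℝ (fun x => e x * g' i x - g x * e' i x) x = _ :=
    (((d he).hasFDerivAt.mul (d (hg' i)).hasFDerivAt).sub
      ((d hg).hasFDerivAt.mul (d (he' i)).hasFDerivAt)).fderiv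
  rw [hD]
  simp only [sub_apply, add_apply, smul_apply, dg, de, dg', de', smul_eq_mul]
  ring

/-- The parametrization of `ℝ³` by which `Λ` corresponds to `ℤ³`. -/
noncomputable def scaleMap : (Fin 3 → ℝ) →L[ℝ] E 3 :=
  (2 : ℝ) • ((EuclideanSpace.equiv (Fin 3) ℝ).symm : (Fin 3 → ℝ) →L[ℝ] E 3)

theorem scaleMap_apply (t : Fin 3 → ℝ) (i : Fin 3) : scaleMap t i = 2 * t i := rfl

theorem scaleMap_single (i : Fin 3) :
    scaleMap (Pi.single i 1) = (2 : ℝ) • EuclideanSpace.basisFun (Fin 3) ℝ i := by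
  ext k
  rw [scaleMap_apply]
  simp [Pi.single_apply]

/-- The group of translations by vectors of `Λ`. -/
def translGroup : Subgroup (E 3 ≃ᵢ E 3) where
  carrier := {g | ∃ v ∈ Lam, g = transl v}
  one_mem' := ⟨0, Lam.zero_mem, IsometryEquiv.ext fun x => (add_zero x).symm⟩
  mul_mem' := by
    rintro _ _ ⟨v, hv, rfl⟩ ⟨w, hw, rfl⟩
    exact ⟨w + v, Lam.add_mem hw hv, IsometryEquiv.ext fun x => add_assoc x w v⟩
  inv_mem' := by
    rintro _ ⟨v, hv, rfl⟩
    refine ⟨-v, Lam.neg_mem hv, IsometryEquiv.ext fun x => (transl v).injective ?_⟩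
    rw [IsometryEquiv.apply_inv_self, transl_apply, transl_apply, neg_add_cancel_right]

theorem apply_add_of_mem_eigenspace {μ : ℝ} {f : E 3 → ℝ} (hf : f ∈ eigenspace translGroup μ)
    {v : E 3} (hv : v ∈ Lam) (x : E 3) : f (x + v) = f x := hf.2.1 _ ⟨v, hv, rfl⟩ x

theorem apply_scaleMap_add_int {μ : ℝ} {f : E 3 → ℝ} (hf : f ∈ eigenspace translGroup μ)
    (t : Fin 3 → ℝ) (m : Fin 3 → ℤ) : f (scaleMap (t + fun i => (m i : ℝ))) = f (scaleMap t) := by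
  rw [map_add]
  exact apply_add_of_mem_eigenspace hf (fun i => ⟨m i, rfl⟩) _

/-- The linear form `t ↦ -2 π i ⟨k, t⟩`. -/
noncomputable def phase (k : Fin 3 → ℤ) : (Fin 3 → ℝ) →L[ℝ] ℂ :=
  ∑ j, (ContinuousLinearMap.proj (R := ℝ) (φ := fun _ : Fin 3 => ℝ) j).smulRight
    (-(2 * Real.pi * Complex.I * k j) : ℂ)

theorem phase_apply (k : Fin 3 → ℤ) (t : Fin 3 → ℝ) :
    phase k t = ∑ j, (t j : ℂ) * -(2 * Real.pi * Complex.I * k j) := by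
  simp [phase]

theorem phase_single (k : Fin 3 → ℤ) (i : Fin 3) :
    phase k (Pi.single i 1) = -(2 * Real.pi * Complex.I * k i) := by
  rw [phase_apply, Finset.sum_eq_single i]
  · simp
  · intro j _ hj
    simp [hj]
  · simp

theorem exp_phase_eq_mFourier (k : Fin 3 → ℤ) (t : Fin 3 → ℝ) :
    Complex.exp (phase k t) =
      UnitAddTorus.mFourier (-k) (fun i => ((t i : ℝ) : UnitAddCircle)) := by
  rw [phase_apply, Complex.exp_sum]
  change _ = ∏ i, fourier ((-k) i) ((t i : ℝ) : UnitAddCircle)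
  refine Finset.prod_congr rfl fun i _ => ?_
  rw [fourier_coe_apply]
  congr 1
  simp
  ring

theorem exp_phase_add_single (k : Fin 3 → ℤ) (i : Fin 3) (t : Fin 3 → ℝ) :
    Complex.exp (phase k (t + Pi.single i 1)) = Complex.exp (phase k t) := by
  rw [map_add, phase_single, Complex.exp_add]
  have : Complex.exp (-(2 * Real.pi * Complex.I * k i)) = 1 :=
    Complex.exp_eq_one_iff.2 ⟨-k i, by push_cast; ring⟩
  rw [this, mul_one]

theorem hasFDerivAt_exp_phase (k : Fin 3 → ℤ) (t : Fin 3 → ℝ) :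
    HasFDerivAt (fun t => Complex.exp (phase k t)) (Complex.exp (phase k t) • phase k) t :=
  (phase k).hasFDerivAt.cexp

/-- The Fourier coefficients of a function on `ℝ³ / Λ`. -/
noncomputable def torusCoeff (k : Fin 3 → ℤ) (f : E 3 → ℝ) : ℂ :=
  ∫ t in Set.Icc (0 : Fin 3 → ℝ) 1, Complex.exp (phase k t) * (f (scaleMap t) : ℂ)

/-- Green's identity pairs two Laplace eigenfunctions: in the scaled variable the eigenvalues are
-4μ for `f` and -4π²|k|² for the exponential, and the integral of their product vanishes when these
differ. -/
theorem torusCoeff_eq_zero {μ : ℝ} {f : E 3 → ℝ} (hf : f ∈ eigenspace translGroup μ)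
    {k : Fin 3 → ℤ} (hk : Real.pi ^ 2 * ∑ i, (k i : ℝ) ^ 2 ≠ μ) : torusCoeff k f = 0 := by
  have hsm : ContDiff ℝ ∞ f := hf.1
  have hsm' : ContDiff ℝ ∞ (fderiv ℝ f) := hsm.fderiv_right (by simp)
  have le : (1 : WithTop ℕ∞) ≤ ∞ := by simp
  have hne : (∞ : WithTop ℕ∞) ≠ 0 := by simp
  let b := EuclideanSpace.basisFun (Fin 3) ℝ
  have cl : ∀ {h : (Fin 3 → ℝ) → ℝ} {h' : (Fin 3 → ℝ) →L[ℝ] ℝ} {t}, HasFDerivAt h h' t →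
      HasFDerivAt (fun t => (h t : ℂ)) (Complex.ofRealCLM.comp h') t := fun hh =>
    Complex.ofRealCLM.hasFDerivAt.comp _ hh
  have csm : ∀ {h : (Fin 3 → ℝ) → ℝ}, ContDiff ℝ 1 h → ContDiff ℝ 1 fun t => (h t : ℂ) := fun hh =>
    Complex.ofRealCLM.contDiff.comp hh
  have hd : ∀ t, HasFDerivAt (fun t => f (scaleMap t)) ((fderiv ℝ f (scaleMap t)).comp scaleMap) t :=
    fun t => ((hsm.differentiable hne _).hasFDerivAt).comp t scaleMap.hasFDerivAt
  have hd' : ∀ (w : E 3) t, HasFDerivAt (fun t => fderiv ℝ f (scaleMap t) w)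
      (((fderiv ℝ (fderiv ℝ f) (scaleMap t)).comp scaleMap).flip w) t := by
    intro w t
    have h1 := ((hsm'.differentiable hne _).hasFDerivAt).comp t scaleMap.hasFDerivAt
    exact ((ContinuousLinearMap.apply ℝ ℝ w).hasFDerivAt.comp t h1)
  have hgreen := integral_green_eq_zero
    (g := fun t => (f (scaleMap t) : ℂ))
    (e := fun t => Complex.exp (phase k t))
    (g' := fun i t => (fderiv ℝ f (scaleMap t) (scaleMap (Pi.single i 1)) : ℂ))
    (e' := fun i t => phase k (Pi.single i 1) * Complex.exp (phase k t))
    (g'' := fun i t => ((4 * iteratedFDeriv ℝ 2 f (scaleMap t) ![b i, b i] : ℝ) : ℂ))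
    (e'' := fun i t => phase k (Pi.single i 1) ^ 2 * Complex.exp (phase k t))
    (csm ((hsm.of_le le).comp scaleMap.contDiff))
    (Complex.contDiff_exp.comp (phase k).contDiff)
    (fun i => csm (((hsm'.of_le le).comp scaleMap.contDiff).clm_apply contDiff_const))
    (fun i => contDiff_const.mul (Complex.contDiff_exp.comp (phase k).contDiff))
    (fun i t => by rw [(cl (hd t)).fderiv]; rfl)
    (fun i t => by
      rw [(hasFDerivAt_exp_phase k t).fderiv, smul_apply, smul_eq_mul, mul_comm])
    (fun i t => by
      rw [(cl (hd' _ t)).fderiv]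
      change ((fderiv ℝ (fderiv ℝ f) (scaleMap t) (scaleMap (Pi.single i 1))
        (scaleMap (Pi.single i 1)) : ℝ) : ℂ) = _
      rw [iteratedFDeriv_two_apply, scaleMap_single]
      simp only [map_smul, smul_apply, smul_eq_mul]
      simp only [Matrix.cons_val_zero, Matrix.cons_val_one, b]
      congr 1
      ring)
    (fun i t => by
      rw [((hasFDerivAt_exp_phase k t).const_mul _).fderiv]
      simp only [smul_apply, smul_eq_mul]
      ring)
    (fun i t => by
      have h1 := apply_scaleMap_add_int hf t (Pi.single i 1)
      have h2 : (fun j => (((Pi.single i 1 : Fin 3 → ℤ) j : ℤ) : ℝ)) = Pi.single i 1 := by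
        ext j
        by_cases h : j = i <;> simp [h]
      rw [h2] at h1
      exact congrArg (fun r : ℝ => (r : ℂ)) h1)
    (fun i t => exp_phase_add_single k i t)
  have hlap : ∀ t, ∑ i, ((4 * iteratedFDeriv ℝ 2 f (scaleMap t) ![b i, b i] : ℝ) : ℂ) =
      ((-4 * μ : ℝ) : ℂ) * (f (scaleMap t) : ℂ) := by
    intro t
    have h1 := hf.2.2 (scaleMap t)
    rw [InnerProductSpace.laplacian_eq_iteratedFDeriv_orthonormalBasis f b] at h1
    rw [← Complex.ofReal_sum, ← Complex.ofReal_mul, ← Finset.mul_sum]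
    congr 1
    linear_combination -4 * h1
  have hsum : ∑ i, phase k (Pi.single i 1) ^ 2 =
      ((-4 * (Real.pi ^ 2 * ∑ i, (k i : ℝ) ^ 2) : ℝ) : ℂ) := by
    simp only [phase_single]
    push_cast
    rw [Finset.mul_sum, Finset.mul_sum]
    refine Finset.sum_congr rfl fun i _ => ?_
    rw [neg_sq, mul_pow, mul_pow, mul_pow, Complex.I_sq]
    ring
  simp only [hlap, ← Finset.sum_mul, hsum] at hgreen
  have heq : ∀ t : Fin 3 → ℝ, Complex.exp (phase k t) * (((-4 * μ : ℝ) : ℂ) * (f (scaleMap t) : ℂ)) -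
      (f (scaleMap t) : ℂ) *
        (((-4 * (Real.pi ^ 2 * ∑ i, (k i : ℝ) ^ 2) : ℝ) : ℂ) * Complex.exp (phase k t)) =
      ((4 * (Real.pi ^ 2 * ∑ i, (k i : ℝ) ^ 2 - μ) : ℝ) : ℂ) *
        (Complex.exp (phase k t) * (f (scaleMap t) : ℂ)) := by
    intro t
    push_cast
    ring
  simp only [heq] at hgreen
  rw [integral_const_mul] at hgreen
  exact (mul_eq_zero.1 hgreen).resolve_left
    (Complex.ofReal_ne_zero.2 (mul_ne_zero four_ne_zero (sub_ne_zero.2 hk)))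

/-- With all coefficients zero the Fourier series is summable, and hence converges pointwise to the
function. -/
theorem eq_zero_of_torusCoeff_eq_zero {μ : ℝ} {f : E 3 → ℝ} (hf : f ∈ eigenspace translGroup μ)
    (h : ∀ k, torusCoeff k f = 0) : f = 0 := by
  let q : C(Fin 3 → ℝ, UnitAddTorus (Fin 3)) :=
    ⟨fun t i => ((t i : ℝ) : UnitAddCircle), by fun_prop⟩
  have hq : Topology.IsQuotientMap q :=
    (IsOpenQuotientMap.piMap fun _ : Fin 3 => (QuotientAddGroup.isOpenQuotientMap_mk :
      IsOpenQuotientMap (QuotientAddGroup.mk : ℝ → UnitAddCircle))).isQuotientMap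
  let G : C(Fin 3 → ℝ, ℂ) := ⟨fun t => (f (scaleMap t) : ℂ), by
    have := hf.1.continuous
    fun_prop⟩
  have hG : Function.FactorsThrough G q := by
    intro s t hst
    have h1 : ∀ i, ∃ m : ℤ, t i = s i + m := by
      intro i
      have h2 := congrFun hst i
      obtain ⟨m, hm⟩ := AddSubgroup.mem_zmultiples_iff.1 (QuotientAddGroup.eq.1 h2)
      refine ⟨m, ?_⟩
      simp at hm
      linarith
    choose m hm using h1
    have h2 : t = s + fun i => (m i : ℝ) := funext hm
    change ((f (scaleMap s) : ℝ) : ℂ) = ((f (scaleMap t) : ℝ) : ℂ)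
    rw [h2, apply_scaleMap_add_int hf]
  let F : C(UnitAddTorus (Fin 3), ℂ) := hq.lift G hG
  have hF : ∀ t, F (q t) = G t := fun t => congrArg (fun k : C(Fin 3 → ℝ, ℂ) => k t)
    (hq.lift_comp G hG)
  have hcoeff : UnitAddTorus.mFourierCoeff F = 0 := by
    funext k
    rw [UnitAddTorus.mFourierCoeff_eq_integral F k 0, Pi.zero_apply, ← h k, torusCoeff]
    have hset : {x : Fin 3 → ℝ | ∀ i, x i ∈ Set.Ioc ((0 : Fin 3 → ℝ) i) ((0 : Fin 3 → ℝ) i + 1)} =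
        Set.univ.pi fun i => Set.Ioc ((0 : Fin 3 → ℝ) i) ((1 : Fin 3 → ℝ) i) := by
      ext x
      simp [Set.mem_pi]
    rw [hset, volume_pi, setIntegral_congr_set Measure.univ_pi_Ioc_ae_eq_Icc]
    refine integral_congr_ae (Filter.Eventually.of_forall fun t => ?_)
    change _ • F (q t) = _
    rw [hF, smul_eq_mul, ← exp_phase_eq_mFourier]
    rfl
  have hsummable : Summable (UnitAddTorus.mFourierCoeff F) := by
    rw [hcoeff]
    exact summable_zero
  funext x
  have hx : scaleMap (fun i => x i / 2) = x := by
    ext i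
    rw [scaleMap_apply]
    ring
  have hs := UnitAddTorus.hasSum_mFourier_series_apply_of_summable hsummable
    (q fun i => x i / 2)
  rw [hcoeff, hF] at hs
  simp only [Pi.zero_apply, zero_smul] at hs
  have h0 : ((f (scaleMap fun i => x i / 2) : ℝ) : ℂ) = 0 := hs.unique hasSum_zero
  rw [hx] at h0
  exact_mod_cast h0

theorem finite_setOf_frequencies (μ : ℝ) :
    {k : Fin 3 → ℤ | Real.pi ^ 2 * ∑ i, (k i : ℝ) ^ 2 = μ}.Finite := by
  refine (Set.finite_Icc (fun _ => -⌈|μ|⌉ : Fin 3 → ℤ) fun _ => ⌈|μ|⌉).subset fun k hk => ?_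
  have h1 : ∀ i, |k i| ≤ ⌈|μ|⌉ := by
    intro i
    have hpi : (1 : ℝ) ≤ Real.pi ^ 2 := by nlinarith [Real.pi_gt_three]
    have h2 : (k i : ℝ) ^ 2 ≤ ∑ i, (k i : ℝ) ^ 2 :=
      Finset.single_le_sum (f := fun i => (k i : ℝ) ^ 2) (fun i _ => sq_nonneg _)
        (Finset.mem_univ i)
    have h3 : ∑ i, (k i : ℝ) ^ 2 ≤ Real.pi ^ 2 * ∑ i, (k i : ℝ) ^ 2 :=
      le_mul_of_one_le_left (Finset.sum_nonneg fun i _ => sq_nonneg _) hpi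
    have h4 : ((|k i| : ℤ) : ℝ) ≤ (k i : ℝ) ^ 2 := by
      have : |k i| ≤ k i ^ 2 := by
        rw [← sq_abs]
        exact Int.le_self_sq _
      exact_mod_cast this
    have h5 : ((|k i| : ℤ) : ℝ) ≤ |μ| :=
      (h4.trans (h2.trans (h3.trans hk.le))).trans (le_abs_self μ)
    exact_mod_cast h5.trans (Int.le_ceil _)
  exact ⟨fun i => (abs_le.1 (h1 i)).1, fun i => (abs_le.1 (h1 i)).2⟩

theorem integrableOn_torusCoeff {f : E 3 → ℝ} (hf : Continuous f) (k : Fin 3 → ℤ) :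
    IntegrableOn (fun t => Complex.exp (phase k t) * (f (scaleMap t) : ℂ))
      (Set.Icc (0 : Fin 3 → ℝ) 1) := by
  refine ContinuousOn.integrableOn_compact isCompact_Icc (Continuous.continuousOn ?_)
  fun_prop

/-- The coefficients at the finitely many frequencies with π²|k|² = μ determine the eigenfunction.
-/
instance finiteDimensional_eigenspace_translGroup (μ : ℝ) :
    FiniteDimensional ℝ (eigenspace translGroup μ) := by
  have := (finite_setOf_frequencies μ).to_subtype
  let K := {k : Fin 3 → ℤ | Real.pi ^ 2 * ∑ i, (k i : ℝ) ^ 2 = μ}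
  let T : eigenspace translGroup μ →ₗ[ℝ] (K → ℂ) :=
    { toFun := fun f k => torusCoeff k f.1
      map_add' := fun f g => by
        funext k
        rw [Pi.add_apply, torusCoeff, torusCoeff, torusCoeff, ← integral_add
          (integrableOn_torusCoeff f.2.1.continuous k) (integrableOn_torusCoeff g.2.1.continuous k)]
        congr 1
        funext t
        rw [Submodule.coe_add, Pi.add_apply, Complex.ofReal_add, mul_add]
      map_smul' := fun c f => by
        funext k
        rw [Pi.smul_apply, torusCoeff, torusCoeff, RingHom.id_apply, ← integral_smul]
        congr 1
        funext t
        rw [Submodule.coe_smul, Pi.smul_apply, smul_eq_mul, Complex.ofReal_mul, Complex.real_smul]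
        ring }
  refine FiniteDimensional.of_injective T ((injective_iff_map_eq_zero T).2 fun f hf => ?_)
  refine Subtype.ext (eq_zero_of_torusCoeff_eq_zero f.2 fun k => ?_)
  by_cases hk : Real.pi ^ 2 * ∑ i, (k i : ℝ) ^ 2 = μ
  · exact congrFun hf ⟨k, hk⟩
  · exact torusCoeff_eq_zero f.2 hk

end Fourier

/-! ### Isospectrality -/

theorem isometryEquiv_eq_linear_add {n : ℕ} (g : E n ≃ᵢ E n) :
    (g : E n → E n) =
      fun x => g.toRealAffineIsometryEquiv.linearIsometryEquiv x + g 0 := by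
  funext x
  have := g.toRealAffineIsometryEquiv.map_vsub x 0
  simp only [IsometryEquiv.coeFn_toRealAffineIsometryEquiv, vsub_eq_sub, sub_zero] at this
  rw [this, sub_add_cancel]

theorem contDiff_isometryEquiv {n : ℕ} (g : E n ≃ᵢ E n) : ContDiff ℝ ∞ g := by
  rw [isometryEquiv_eq_linear_add g]
  exact (LinearIsometryEquiv.contDiff _).add contDiff_const

/-- The linear part carries an orthonormal basis to another one, and either computes the Laplacian.
-/
theorem laplacian_comp_isometryEquiv {n : ℕ} {f : E n → ℝ} (hf : ContDiff ℝ ∞ f) (g : E n ≃ᵢ E n)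
    (x : E n) : Laplacian.laplacian (fun y => f (g y)) x = Laplacian.laplacian f (g x) := by
  let L := g.toRealAffineIsometryEquiv.linearIsometryEquiv
  let b := EuclideanSpace.basisFun (Fin n) ℝ
  have h2 : (2 : WithTop ℕ∞) ≤ ∞ := by exact WithTop.coe_le_coe.2 le_top
  have hfa : ContDiff ℝ 2 fun z => f (z + g 0) :=
    (hf.of_le h2).comp (contDiff_id.add contDiff_const)
  have hcomp : (fun y => f (g y)) = (fun z => f (z + g 0)) ∘ (L : E n →L[ℝ] E n) := by
    funext y
    exact congrArg f (congrFun (isometryEquiv_eq_linear_add g) y)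
  have hgx : g x = L x + g 0 := congrFun (isometryEquiv_eq_linear_add g) x
  rw [InnerProductSpace.laplacian_eq_iteratedFDeriv_orthonormalBasis _ b,
    InnerProductSpace.laplacian_eq_iteratedFDeriv_orthonormalBasis f (b.map L)]
  refine Finset.sum_congr rfl fun i _ => ?_
  rw [hcomp, ContinuousLinearMap.iteratedFDeriv_comp_right _ hfa x le_rfl, hgx]
  rw [ContinuousMultilinearMap.compContinuousLinearMap_apply]
  have hshift : iteratedFDeriv ℝ 2 (fun z => f (z + g 0)) (L x) =
      iteratedFDeriv ℝ 2 f (L x + g 0) := iteratedFDeriv_comp_add_right 2 (g 0) (L x)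
  refine (DFunLike.congr_fun hshift _).trans
    (congrArg (iteratedFDeriv ℝ 2 f (L x + g 0)) (funext fun k => ?_))
  fin_cases k
  · exact (b.map_apply L i).symm
  · exact (b.map_apply L i).symm

/-- The action of the isometries normalizing `Λ` on the eigenspaces of the torus. -/
noncomputable def pullback (μ : ℝ) (g : signedGroup) :
    eigenspace translGroup μ →ₗ[ℝ] eigenspace translGroup μ where
  toFun f := ⟨fun x => f.1 (g.1 x), f.2.1.comp (contDiff_isometryEquiv g.1), by
    rintro _ ⟨v, hv, rfl⟩ x
    have h := apply_add_of_mem_eigenspace f.2 (mapsCosets_of_mem_signedGroup g.2 x v hv) (g.1 x)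
    rwa [add_sub_cancel] at h, fun x => by
    rw [laplacian_comp_isometryEquiv f.2.1, f.2.2.2]⟩
  map_add' _ _ := rfl
  map_smul' _ _ := rfl

theorem pullback_mul (μ : ℝ) (g h : signedGroup) :
    pullback μ (g * h) = pullback μ h * pullback μ g := rfl

theorem pullback_apply (μ : ℝ) (g : signedGroup) (f : eigenspace translGroup μ) (x : E 3) :
    (pullback μ g f).1 x = f.1 (g.1 x) := rfl

theorem trace_pullback_eq {μ : ℝ} {g h c : signedGroup} (hc : c * g = h * c) :
    LinearMap.trace ℝ _ (pullback μ g) = LinearMap.trace ℝ _ (pullback μ h) := by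
  have h1 : g = c⁻¹ * (h * c) := by rw [← hc, inv_mul_cancel_left]
  rw [h1, pullback_mul, LinearMap.trace_mul_comm, ← pullback_mul, mul_inv_cancel_right]

section Averaging

variable {Γ : Subgroup (E 3 ≃ᵢ E 3)} {b : Fin 4 → E 3} {c : Fin 4 → Fin 3 → ℤ}

theorem HasOffsets.eigenspace_le (h : HasOffsets Γ c) (h0 : c 0 = 0) (μ : ℝ) :
    eigenspace Γ μ ≤ eigenspace translGroup μ := by
  rintro f ⟨h1, h2, h3⟩
  refine ⟨h1, ?_, h3⟩
  rintro _ ⟨v, hv, rfl⟩ x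
  exact h2 _ (h.transl_mem h0 hv) x

theorem rho_mem_signedGroup (hb : ∀ j i, b j i = c j i) (j : Fin 4) : rho b j ∈ signedGroup := by
  refine ⟨(1, fun i => if sgn j i = 1 then 1 else -1, fun i => 2 * (sgn j i * c j i)),
    fun x i => ?_⟩
  rw [rho_apply, hb]
  rcases sgn_cases j i with h | h <;> simp [h]
  ring

/-- The projection of an eigenspace of the torus to the functions invariant under the `ρ_j`. -/
noncomputable def average (hb : ∀ j i, b j i = c j i) (μ : ℝ) :
    eigenspace translGroup μ →ₗ[ℝ] eigenspace translGroup μ :=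
  (1 / 4 : ℝ) • ∑ j, pullback μ ⟨rho b j, rho_mem_signedGroup hb j⟩

theorem average_apply (hb : ∀ j i, b j i = c j i) (μ : ℝ) (f : eigenspace translGroup μ) (x : E 3) :
    (average hb μ f).1 x = 1 / 4 * ∑ j, f.1 (rho b j x) := by
  simp [average, LinearMap.sum_apply, pullback_apply]

/-- Right multiplication by `g` permutes the cosets of the lattice translations: ρ_j g and ρ_{j xor
k} differ by lattice vectors, which periodic functions do not see. -/
theorem HasOffsets.apply_rho (h : HasOffsets Γ c) (hb : ∀ j i, b j i = c j i)
    (hc : ∀ j k i, (c j i + sgn j i * c k i - c (j ^^^ k) i) % 2 = 0) {g : E 3 ≃ᵢ E 3}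
    (hg : g ∈ Γ) : ∃ k, ∀ (μ : ℝ) (f : eigenspace translGroup μ) (j : Fin 4) (x : E 3),
      f.1 (rho b j (g x)) = f.1 (rho b (j ^^^ k) x) := by
  obtain ⟨k, m, hm⟩ := (h g).1 hg
  refine ⟨k, fun μ f j x => ?_⟩
  choose d hd using fun i => Int.dvd_of_emod_eq_zero (hc j k i)
  have hv : rho b j (g x) - rho b (j ^^^ k) x ∈ Lam := by
    intro i
    obtain ⟨q, e1⟩ : ∃ q : ℤ,
        sgn j i * c j i + sgn j i * c k i - sgn (j ^^^ k) i * c (j ^^^ k) i = 2 * q := by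
      -- The half-difference `d` from the cocycle condition is corrected for the offsets whose sign
      -- is reversed.
      refine ⟨d i + (if sgn j i = 1 then 0 else -c j i) +
        if sgn (j ^^^ k) i = 1 then 0 else c (j ^^^ k) i, ?_⟩
      have := hd i
      rcases sgn_cases j i with e | e <;> rcases sgn_cases (j ^^^ k) i with e' | e' <;>
        simp only [e, e'] at this ⊢ <;> norm_num <;> linarith
    refine ⟨sgn j i * m i + q, ?_⟩
    rw [PiLp.sub_apply, rho_apply, rho_apply, hm, hb, hb]
    have e2 := congrArg (Int.cast : ℤ → ℝ) e1
    have e3 := congrArg (Int.cast : ℤ → ℝ) (sgn_xor j k i)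
    push_cast at e2 e3 ⊢
    linear_combination e2 - x i * e3
  have := apply_add_of_mem_eigenspace f.2 hv (rho b (j ^^^ k) x)
  rwa [add_sub_cancel] at this

theorem HasOffsets.isProj_average (h : HasOffsets Γ c) (hb : ∀ j i, b j i = c j i)
    (hc : ∀ j k i, (c j i + sgn j i * c k i - c (j ^^^ k) i) % 2 = 0)
    (hΓ : (Γ : Set (E 3 ≃ᵢ E 3)) = rhoSet b) (μ : ℝ) :
    LinearMap.IsProj ((eigenspace Γ μ).comap (eigenspace translGroup μ).subtype)
      (average hb μ) := by
  constructor
  · intro f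
    refine ⟨(average hb μ f).2.1, fun g hg x => ?_, (average hb μ f).2.2.2⟩
    obtain ⟨k, hk⟩ := h.apply_rho hb hc hg
    change (average hb μ f).1 (g x) = (average hb μ f).1 x
    rw [average_apply, average_apply]
    congr 1
    -- Xor with `k` is an involution of the indices, so it only reorders the average.
    have hinv : ∀ k : Fin 4, Function.Involutive fun j : Fin 4 => j ^^^ k := by
      unfold Function.Involutive
      decide
    exact Fintype.sum_equiv (hinv k).toPerm _ _ fun j => hk μ f j x
  · intro f hf
    refine Subtype.ext (funext fun x => ?_)
    rw [average_apply]
    have : ∀ j, f.1 (rho b j x) = f.1 x := fun j => hf.2.1 _ (rho_mem hΓ j) x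
    simp only [this, Finset.sum_const, Finset.card_univ, Fintype.card_fin, nsmul_eq_mul]
    push_cast
    ring

/-- The trace of a projection is the dimension of its image. -/
theorem HasOffsets.finrank_eigenspace (h : HasOffsets Γ c) (h0 : c 0 = 0)
    (hb : ∀ j i, b j i = c j i)
    (hc : ∀ j k i, (c j i + sgn j i * c k i - c (j ^^^ k) i) % 2 = 0)
    (hΓ : (Γ : Set (E 3 ≃ᵢ E 3)) = rhoSet b) (μ : ℝ) :
    (Module.finrank ℝ (eigenspace Γ μ) : ℝ) =
      1 / 4 * ∑ j, LinearMap.trace ℝ _ (pullback μ ⟨rho b j, rho_mem_signedGroup hb j⟩) := by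
  have (V : Submodule ℝ (eigenspace translGroup μ)) : Module.Free ℝ V :=
    Module.Free.of_divisionRing ℝ V
  have (V : Submodule ℝ (eigenspace translGroup μ)) : Module.Finite ℝ V :=
    FiniteDimensional.finiteDimensional_submodule V
  rw [← (Submodule.comapSubtypeEquivOfLe (h.eigenspace_le h0 μ)).finrank_eq,
    ← (h.isProj_average hb hc hΓ μ).trace, average, map_smul, map_sum, smul_eq_mul]

end Averaging

theorem isospectral : Isospectral Gam₁ Gam₂ := by
  intro μ
  refine ⟨Submodule.finiteDimensional_of_le (hasOffsets₁.eigenspace_le (by decide) μ),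
    Submodule.finiteDimensional_of_le (hasOffsets₂.eigenspace_le (by decide) μ), ?_⟩
  have h₁ := hasOffsets₁.finrank_eigenspace (by decide) trans₁_apply (by decide) coe_Gam₁ μ
  have h₂ := hasOffsets₂.finrank_eigenspace (by decide) trans₂_apply (by decide) coe_Gam₂ μ
  have : (Module.finrank ℝ (eigenspace Gam₁ μ) : ℝ) = Module.finrank ℝ (eigenspace Gam₂ μ) := by
    rw [h₁, h₂]
    congr 1
    exact Finset.sum_congr rfl fun j _ => trace_pullback_eq
      (c := ⟨conjIsom j, permSet_subset_signedGroup (conjIsom_mem j)⟩)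
      (Subtype.ext (conjIsom_mul_rho j))
  exact_mod_cast this

theorem sunadaIsospectralVia_bigGroup :
    SunadaIsospectralVia bigGroup (inducedGroup Lam Gam₁) (inducedGroup Lam Gam₂) Gam₁ Gam₂ where
  le₁ := inducedGroup₁_le
  le₂ := inducedGroup₂_le
  almostConjugate := almostConjugate_inducedGroups
  quotient₁ := hasOffsets₁.orbifoldIsometric (by decide)
  quotient₂ := hasOffsets₂.orbifoldIsometric (by decide)
  isospectral := isospectral

theorem exists_induces_of_mem {g : E 3 ≃ᵢ E 3}
    (hg : g ∈ (Gam₁ : Set (E 3 ≃ᵢ E 3)) ∪ Gam₂ ∪ permSet) :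
    ∃ h : Torus Lam ≃ᵢ Torus Lam, Induces g h := by
  refine exists_induces_of_mem_signedGroup ?_
  rcases hg with (hg | hg) | hg
  · exact hasOffsets₁.le_signedGroup hg
  · exact hasOffsets₂.le_signedGroup hg
  · exact permSet_subset_signedGroup hg

end FlatOrbifold

theorem mainTheorem9 :
    -- the two sets are groups, discrete and cocompact
    ((Gam₁ : Set (E 3 ≃ᵢ E 3)) = rhoSet trans₁ ∧ (Gam₂ : Set (E 3 ≃ᵢ E 3)) = rhoSet trans₂) ∧
    (IsCrystallographic Gam₁ ∧ IsCrystallographic Gam₂) ∧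
    -- the orbifolds are not orientable
    (¬ Orientable Gam₁ ∧ ¬ Orientable Gam₂) ∧
    -- a common fundamental domain; the underlying space of the first orbifold
    (IsClosedFundamentalDomain Gam₁ box ∧ IsClosedFundamentalDomain Gam₂ box) ∧
    Nonempty (OrbitSpace Gam₁ ≃ₜ ProjectivePlane × Circle) ∧
    -- the elements of the groups and the maps `B L_b` descend to the torus, and the induced groups
    -- consist of the classes of the `ρ_j`
    ((∀ g ∈ (Gam₁ : Set (E 3 ≃ᵢ E 3)) ∪ Gam₂ ∪ permSet,
        ∃ h : Torus Lam ≃ᵢ Torus Lam, Induces g h) ∧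
      (inducedGroup Lam Gam₁ : Set (Torus Lam ≃ᵢ Torus Lam)) =
        {h | ∃ j, Induces (rho trans₁ j) h} ∧
      (inducedGroup Lam Gam₂ : Set (Torus Lam ≃ᵢ Torus Lam)) =
        {h | ∃ j, Induces (rho trans₂ j) h}) ∧
    -- Sunada isospectrality by means of the finite group `G`
    (Finite bigGroup ∧
      SunadaIsospectralVia bigGroup (inducedGroup Lam Gam₁) (inducedGroup Lam Gam₂) Gam₁ Gam₂) ∧
    -- the orbifolds are not isometric
    ¬ OrbifoldIsometric Gam₁ Gam₂ ∧
    -- fixed points and isotropy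
    (∀ Γ ∈ ({Gam₁, Gam₂} : Set (Subgroup (E 3 ≃ᵢ E 3))),
      {x : E 3 | ∃ g ∈ Γ, g ≠ 1 ∧ g x = x} = verticalLines ∧
      ∀ x ∈ verticalLines, (∃! g : E 3 ≃ᵢ E 3, g ∈ Γ ∧ g ≠ 1 ∧ g x = x) ∧
        Nonempty (isotropy Γ x ≃* Multiplicative (ZMod 2))) ∧
    -- singular sets: two circles of length two, respectively four circles of length one
    (IsDisjointUnionOfCircles Gam₁ (singularSet Gam₁) 2 2 ∧
      IsDisjointUnionOfCircles Gam₂ (singularSet Gam₂) 4 1 ∧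
      Nat.card (ConnectedComponents (singularSet Gam₁)) = 2 ∧
      Nat.card (ConnectedComponents (singularSet Gam₂)) = 4) :=
  ⟨⟨coe_Gam₁, coe_Gam₂⟩, ⟨isCrystallographic₁, isCrystallographic₂⟩,
    ⟨hasOffsets₁.not_orientable, hasOffsets₂.not_orientable⟩,
    ⟨isClosedFundamentalDomain_box₁, isClosedFundamentalDomain_box₂⟩,
    nonempty_homeomorph_projectivePlane_prod_circle,
    ⟨fun _ hg => exists_induces_of_mem hg, inducedGroup_eq coe_Gam₁, inducedGroup_eq coe_Gam₂⟩,
    ⟨finite_bigGroup, sunadaIsospectralVia_bigGroup⟩, not_orbifoldIsometric,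
    fun _ hΓ => ⟨setOf_fixed_eq hΓ,
      fun _ hx => ⟨existsUnique_fixing hΓ hx, nonempty_isotropy_equiv hΓ hx⟩⟩,
    ⟨isDisjointUnionOfCircles₁, isDisjointUnionOfCircles₂, card_components₁, card_components₂⟩⟩
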